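/- Let $S$ be a locally compact Hausdorff topological semigroup (jointly continuous multiplication) with identity, and let $\omega:S\to(0,\infty)$ be a weight function, i.e. $\omega$ is continuous and $\omega(xy)\le\omega(x)\omega(y)$ for all $x,y\in S$. Let $M(S)$ be the Banach space of bounded complex Radon measures on $S$ with the total variation norm, and let $M_a(S)$ be the set of all $\mu\in M(S)$ for which the maps $x\mapsto\delta_x*|\mu|$ and $x\mapsto|\mu|*\delta_x$ from $S$ to $M(S)$ are continuous for the weak topology $\sigma(M(S),M(S)')$. Suppose that $S$ is a foundation semigroup, i.e. $S$ is the closure of $\bigcup\{\operatorname{supp}\mu:\mu\in M_a(S)\}$. Let $M(S,\omega)$ be the space of all complex Radon measures $\mu$ on $S$ (not necessarily bounded) with $\omega\mu\in M(S)$, with norm $\|\mu\|_\omega=\int_S\omega\,d|\mu|$ and convolution $(\mu*\nu)(f)=\int_S\int_S f(xy)\,d\mu(x)\,d\nu(y)$ for $f\in C_c(S)$. Let $M_a(S,\omega)=\{\mu\in M(S,\omega):\omega\mu\in M_a(S)\}$, and let $\ell^1(S,\omega)\subseteq M(S,\omega)$ be the set of discrete measures $\sum_{x\in S}c(x)\delta_x$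 with $\sum_{x\in S}|c(x)|\,\omega(x)<\infty$. Then $\ell^1(S,\omega)$ is dense in $M(S,\omega)$ for the strict topology (so), the locally convex topology defined by the seminorms $$p_\nu(\mu)=\|\mu*\nu\|_\omega+\|\nu*\mu\|_\omega\qquad(\nu\in M_a(S,\omega)).$$ -/

import Mathlib

open MeasureTheory Filter Topology Set
open scoped ENNReal NNReal CompactlySupported

set_option linter.unusedSectionVars false

namespace FoundationSemigroup

section Radon

variable {S : Type*} [MeasurableSpace S]

/-- A finite positive measure, viewed as a complex measure. -/
noncomputable def ofMeasure (m : Measure S) [IsFiniteMeasure m] : ComplexMeasure S :=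
  m.toSignedMeasure.toComplexMeasure 0

theorem ofMeasure_apply (m : Measure S) [IsFiniteMeasure m] {A : Set S} (hA : MeasurableSet A) :
    ofMeasure m A = (m.real A : ℂ) := by
  simp [ofMeasure, SignedMeasure.toComplexMeasure_apply, Measure.toSignedMeasure_apply, hA]
  rfl

theorem variation_ofMeasure_le (m : Measure S) [IsFiniteMeasure m] :
    (ofMeasure m).variation ≤ m := by
  refine VectorMeasure.variation_le_of_forall_enorm_le fun E hE => ?_
  rw [ofMeasure_apply m hE, ← ofReal_norm]
  simp [Measure.real]

theorem decomposition (ν : ComplexMeasure S) :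
    ν = ofMeasure (ComplexMeasure.re ν).toJordanDecomposition.posPart
      - ofMeasure (ComplexMeasure.re ν).toJordanDecomposition.negPart
      + Complex.I • (ofMeasure (ComplexMeasure.im ν).toJordanDecomposition.posPart
      - ofMeasure (ComplexMeasure.im ν).toJordanDecomposition.negPart) := by
  ext A hA
  have h1 := (ComplexMeasure.re ν).apply_eq_posPart_real_sub_negPart_real hA
  have h2 := (ComplexMeasure.im ν).apply_eq_posPart_real_sub_negPart_real hA
  simp only [_root_.add_apply, _root_.sub_apply, _root_.smul_apply,
    ofMeasure_apply _ hA]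
  apply Complex.ext
  · simpa using! h1
  · simpa using! h2

instance isFiniteMeasure_variation (ν : ComplexMeasure S) : IsFiniteMeasure ν.variation := by
  have h : ∀ (m : Measure S) [IsFiniteMeasure m], IsFiniteMeasure (ofMeasure m).variation :=
    fun m _ => isFiniteMeasure_of_le m (variation_ofMeasure_le m)
  have h' : ∀ (a b : ComplexMeasure S), IsFiniteMeasure a.variation → IsFiniteMeasure b.variation →
    IsFiniteMeasure (a - b).variation := fun a b _ _ =>
      isFiniteMeasure_of_le _ VectorMeasure.variation_sub_le
  rw [decomposition ν]
  have i1 := h' _ _ (h (ComplexMeasure.re ν).toJordanDecomposition.posPart)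
    (h (ComplexMeasure.re ν).toJordanDecomposition.negPart)
  have i2 := h' _ _ (h (ComplexMeasure.im ν).toJordanDecomposition.posPart)
    (h (ComplexMeasure.im ν).toJordanDecomposition.negPart)
  exact isFiniteMeasure_of_le _ VectorMeasure.variation_add_le

theorem variation_ofMeasure (m : Measure S) [IsFiniteMeasure m] :
    (ofMeasure m).variation = m := by
  refine le_antisymm (variation_ofMeasure_le m) (Measure.le_iff.2 fun E hE => ?_)
  refine le_trans (le_of_eq ?_) (VectorMeasure.enorm_measure_le_variation _ E)
  rw [ofMeasure_apply m hE, ← ofReal_norm]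
  simp [Measure.real]

/-- The integral `∫ f dν` of a complex function against a complex measure. -/
noncomputable def cint (ν : ComplexMeasure S) (f : S → ℂ) : ℂ :=
  ν.integral f (ContinuousLinearMap.mul ℝ ℂ)

theorem cint_ofMeasure (m : Measure S) [IsFiniteMeasure m] (f : S → ℂ) :
    cint (ofMeasure m) f = ∫ x, f x ∂m := by
  rw [cint, VectorMeasure.integral_eq_setToFun, MeasureTheory.integral_eq_setToFun]
  simp only [variation_ofMeasure]
  apply setToFun_congr_left' _ _ (fun s hs h's ↦ ?_)
  ext1
  simp [VectorMeasure.transpose, ofMeasure_apply m hs, weightedSMul_apply]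

theorem cint_congr {ν : ComplexMeasure S} {f g : S → ℂ} (h : ∀ x, f x = g x) :
    cint ν f = cint ν g := by
  rw [funext h]

theorem cint_add {ν : ComplexMeasure S} {f g : S → ℂ} (hf : Integrable f ν.variation)
    (hg : Integrable g ν.variation) : cint ν (fun x => f x + g x) = cint ν f + cint ν g :=
  VectorMeasure.integral_fun_add hf hg

theorem cint_const_mul (ν : ComplexMeasure S) (c : ℂ) (f : S → ℂ) :
    cint ν (fun x => c * f x) = c * cint ν f := by
  rw [cint, cint, VectorMeasure.integral_eq_setToFun, VectorMeasure.integral_eq_setToFun]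
  have := setToFun_smul (dominatedFinMeasAdditive_cbmApplyMeasure ν
    (ContinuousLinearMap.mul ℝ ℂ)) (𝕜 := ℂ) (fun c s x => by
      simp [VectorMeasure.transpose, mul_left_comm]) c f
  simpa [Pi.smul_def] using this

theorem integrable_smul_measure {ν : ComplexMeasure S} {f : S → ℂ} (c : ℂ)
    (hf : Integrable f ν.variation) : Integrable f (c • ν).variation := by
  rw [VectorMeasure.variation_smul]
  exact hf.smul_measure_nnreal

theorem cint_smul_measure {ν : ComplexMeasure S} {f : S → ℂ} (c : ℂ)
    (hf : Integrable f ν.variation) : cint (c • ν) f = c * cint ν f := by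
  have hdom : DominatedFinMeasAdditive ν.variation
      ((c • ν).transpose (ContinuousLinearMap.mul ℝ ℂ))
      (‖ContinuousLinearMap.mul ℝ ℂ‖ * ‖c‖) := by
    refine ⟨fun s t hs ht h1 h2 hd => (dominatedFinMeasAdditive_cbmApplyMeasure (c • ν) _).1 s t hs
      ht (measure_ne_top _ _) (measure_ne_top _ _) hd, fun s hs h1 => ?_⟩
    have := (dominatedFinMeasAdditive_cbmApplyMeasure (c • ν)
      (ContinuousLinearMap.mul ℝ ℂ)).2 s hs (measure_lt_top _ _)
    refine this.trans (le_of_eq ?_)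
    rw [VectorMeasure.variation_smul, mul_assoc]
    simp [Measure.real]
  have h1 : cint (c • ν) f = setToFun ν.variation _ hdom f :=
    (setToFun_congr_measure_of_integrable (‖c‖₊ : ℝ≥0∞) (by simp)
      (by rw [VectorMeasure.variation_smul]; exact le_of_eq rfl) hdom _ f hf).symm
  rw [h1, cint, VectorMeasure.integral_eq_setToFun]
  refine hf.induction (P := fun f => setToFun ν.variation _ hdom f = c * setToFun ν.variation _
    (dominatedFinMeasAdditive_cbmApplyMeasure ν (ContinuousLinearMap.mul ℝ ℂ)) f) ?_ ?_ ?_ ?_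
  · intro d s hs h2
    rw [setToFun_indicator_const _ hs h2.ne, setToFun_indicator_const _ hs h2.ne]
    simp [VectorMeasure.transpose, mul_assoc]
  · intro g h _ hg hh e1 e2
    rw [setToFun_add _ hg hh, setToFun_add _ hg hh, e1, e2, mul_add]
  · exact isClosed_eq (continuous_setToFun hdom) (continuous_const.mul (continuous_setToFun _))
  · intro g h hgh _ e
    rw [← setToFun_congr_ae _ hgh, e, setToFun_congr_ae _ hgh]

theorem cint_add_measure {ν ν' : ComplexMeasure S} {f : S → ℂ} (hf : Integrable f ν.variation)
    (hf' : Integrable f ν'.variation) : cint (ν + ν') f = cint ν f + cint ν' f :=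
  VectorMeasure.integral_add_vectorMeasure hf hf'

theorem norm_cint_le (ν : ComplexMeasure S) (f : S → ℂ) :
    ‖cint ν f‖ ≤ ∫ x, ‖f x‖ ∂ν.variation := by
  refine VectorMeasure.norm_integral_le_integral_norm.trans ?_
  simp

end Radon

section Regular

variable {S : Type*} [TopologicalSpace S] [T2Space S] [MeasurableSpace S] [BorelSpace S]

theorem regular_of_le {ρ m : Measure S} [IsFiniteMeasure m] [m.Regular] (h : ρ ≤ m) :
    ρ.Regular := by
  have hρ : IsFiniteMeasure ρ := isFiniteMeasure_of_le m h
  have : ρ.InnerRegularCompactLTTop := by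
    constructor
    rintro A ⟨hA, hA'⟩ r hr
    obtain ⟨K, hKA, hK, hlt⟩ := hA.exists_isCompact_sdiff_lt (measure_ne_top m A)
      (ε := ρ A - r) (tsub_pos_of_lt hr).ne'
    refine ⟨K, hKA, hK, ?_⟩
    by_contra! hle
    have h1 : ρ A ≤ ρ K + ρ (A \ K) := by
      rw [measure_add_sdiff hK.nullMeasurableSet]
      exact measure_mono subset_union_right
    have h2 : ρ (A \ K) < ρ A - r := (h _).trans_lt hlt
    have h3 : ρ A < r + (ρ A - r) :=
      h1.trans_lt (ENNReal.add_lt_add_of_le_of_lt (measure_ne_top _ _) hle h2)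
    rw [add_tsub_cancel_of_le hr.le] at h3
    exact h3.false
  infer_instance

theorem regular_add {m m' : Measure S} [IsFiniteMeasure m] [IsFiniteMeasure m'] (h : m.Regular)
    (h' : m'.Regular) : (m + m').Regular := by
  infer_instance

theorem regular_map {T : Type*} [TopologicalSpace T] [T2Space T] [MeasurableSpace T] [BorelSpace T]
    {m : Measure S} [IsFiniteMeasure m] (h : m.Regular) {φ : S → T} (hφ : Continuous φ) :
    (m.map φ).Regular := by
  have := Measure.InnerRegularCompactLTTop.map_of_continuous (μ := m) hφ
  infer_instance

variable (S) in
/-- The complex measures whose total variation is a Radon measure. -/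
def radonSubmodule : Submodule ℂ (ComplexMeasure S) where
  carrier := {ν | ν.variation.Regular}
  zero_mem' := by
    simp only [mem_ofPred_eq, VectorMeasure.variation_zero]
    infer_instance
  add_mem' {a b} ha hb := by
    have := regular_add ha hb
    exact regular_of_le VectorMeasure.variation_add_le
  smul_mem' c a ha := by
    have : a.variation.Regular := ha
    simp only [mem_ofPred_eq, VectorMeasure.variation_smul]
    infer_instance

theorem ofMeasure_mem (m : Measure S) [IsFiniteMeasure m] [h : m.Regular] :
    ofMeasure m ∈ radonSubmodule S := by
  change (ofMeasure m).variation.Regular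
  rwa [variation_ofMeasure]

theorem posPart_regular {ν : ComplexMeasure S} (hν : ν ∈ radonSubmodule S) :
    (ComplexMeasure.re ν).toJordanDecomposition.posPart.Regular ∧
    (ComplexMeasure.re ν).toJordanDecomposition.negPart.Regular ∧
    (ComplexMeasure.im ν).toJordanDecomposition.posPart.Regular ∧
    (ComplexMeasure.im ν).toJordanDecomposition.negPart.Regular := by
  have : ν.variation.Regular := hν
  have hre : (ComplexMeasure.re ν).totalVariation ≤ ν.variation := by
    rw [SignedMeasure.totalVariation_eq_variation]
    refine VectorMeasure.variation_le_of_forall_enorm_le fun E hE => ?_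
    refine le_trans ?_ (VectorMeasure.enorm_measure_le_variation ν E)
    rw [← ofReal_norm, ← ofReal_norm]
    exact ENNReal.ofReal_le_ofReal (Complex.abs_re_le_norm _)
  have him : (ComplexMeasure.im ν).totalVariation ≤ ν.variation := by
    rw [SignedMeasure.totalVariation_eq_variation]
    refine VectorMeasure.variation_le_of_forall_enorm_le fun E hE => ?_
    refine le_trans ?_ (VectorMeasure.enorm_measure_le_variation ν E)
    rw [← ofReal_norm, ← ofReal_norm]
    exact ENNReal.ofReal_le_ofReal (Complex.abs_im_le_norm _)
  exact ⟨regular_of_le ((Measure.le_add_right le_rfl).trans hre),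
    regular_of_le ((Measure.le_add_left le_rfl).trans hre),
    regular_of_le ((Measure.le_add_right le_rfl).trans him),
    regular_of_le ((Measure.le_add_left le_rfl).trans him)⟩

/-- Every complex Radon measure is a combination of positive ones. -/
theorem radon_induction {P : ComplexMeasure S → Prop}
    (pos : ∀ (m : Measure S) [IsFiniteMeasure m] [m.Regular], P (ofMeasure m))
    (add : ∀ a ∈ radonSubmodule S, ∀ b ∈ radonSubmodule S, P a → P b → P (a + b))
    (smul : ∀ (c : ℂ), ∀ a ∈ radonSubmodule S, P a → P (c • a))
    {ν : ComplexMeasure S} (hν : ν ∈ radonSubmodule S) : P ν := by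
  obtain ⟨h1, h2, h3, h4⟩ := posPart_regular hν
  have key : ∀ (m m' : Measure S) [IsFiniteMeasure m] [IsFiniteMeasure m'] [m.Regular]
      [m'.Regular], ofMeasure m - ofMeasure m' ∈ radonSubmodule S ∧
        P (ofMeasure m - ofMeasure m') := by
    intro m m' _ _ _ _
    refine ⟨Submodule.sub_mem _ (ofMeasure_mem m) (ofMeasure_mem m'), ?_⟩
    rw [sub_eq_add_neg, ← neg_one_smul ℂ]
    exact add _ (ofMeasure_mem m) _ (Submodule.smul_mem _ _ (ofMeasure_mem m')) (pos m)
      (smul _ _ (ofMeasure_mem m') (pos m'))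
  rw [decomposition ν]
  have k1 := key (ComplexMeasure.re ν).toJordanDecomposition.posPart
    (ComplexMeasure.re ν).toJordanDecomposition.negPart
  have k2 := key (ComplexMeasure.im ν).toJordanDecomposition.posPart
    (ComplexMeasure.im ν).toJordanDecomposition.negPart
  exact add _ k1.1 _ (Submodule.smul_mem _ _ k2.1) k1.2 (smul _ _ k2.1 k2.2)

theorem integrable_of_continuous (m : Measure S) [IsFiniteMeasure m] {f : S → ℂ}
    (hf : Continuous f) (C : ℝ) (hC : ∀ x, ‖f x‖ ≤ C) : Integrable f m :=
  Integrable.of_bound hf.aestronglyMeasurable C (Eventually.of_forall hC)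

theorem integrable_cc (m : Measure S) [IsFiniteMeasure m] (f : C_c(S, ℂ)) : Integrable f m := by
  obtain ⟨C, hC⟩ := f.hasCompactSupport.exists_bound_of_continuous f.continuous
  exact integrable_of_continuous m f.continuous C hC

theorem eq_zero_of_cint [LocallyCompactSpace S] {ν : ComplexMeasure S} (hν : ν ∈ radonSubmodule S)
    (h : ∀ f : C_c(S, ℂ), cint ν f = 0) : ν = 0 := by
  obtain ⟨h1, h2, h3, h4⟩ := posPart_regular hν
  have key : ∀ f : C_c(S, ℝ),
      ∫ x, f x ∂(ComplexMeasure.re ν).toJordanDecomposition.posPart =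
        ∫ x, f x ∂(ComplexMeasure.re ν).toJordanDecomposition.negPart ∧
      ∫ x, f x ∂(ComplexMeasure.im ν).toJordanDecomposition.posPart =
        ∫ x, f x ∂(ComplexMeasure.im ν).toJordanDecomposition.negPart := by
    intro f
    let g : C_c(S, ℂ) := ⟨⟨fun x => (f x : ℂ), by fun_prop⟩,
      f.hasCompactSupport.comp_left (g := fun t : ℝ => (t : ℂ)) (by simp)⟩
    have hg : ∀ x, g x = f x := fun x => rfl
    have := h g
    have i (a : ComplexMeasure S) : Integrable g a.variation := integrable_cc _ g
    rw [decomposition ν] at this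
    simp only [sub_eq_add_neg, ← neg_one_smul ℂ (ofMeasure _)] at this
    rw [cint_add_measure (i _) (i _), cint_smul_measure _ (i _), cint_add_measure (i _) (i _),
      cint_add_measure (i _) (i _), cint_smul_measure _ (i _), cint_smul_measure _ (i _)] at this
    simp only [cint_ofMeasure, hg, integral_complex_ofReal] at this
    have e1 := congrArg Complex.re this
    have e2 := congrArg Complex.im this
    simp [-ComplexMeasure.re_apply, -ComplexMeasure.im_apply] at e1 e2
    exact ⟨by linarith, by linarith⟩
  have e1 := Measure.ext_of_integral_eq_on_compactlySupported fun f => (key f).1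
  have e2 := Measure.ext_of_integral_eq_on_compactlySupported fun f => (key f).2
  have d := decomposition ν
  simp only [e1, e2, sub_self, smul_zero, add_zero] at d
  exact d

/-- Integrating out one variable of a bounded continuous function gives a continuous function. -/
theorem continuous_cint {T : Type*} [TopologicalSpace T] {ν : ComplexMeasure S}
    (hν : ν ∈ radonSubmodule S) {h : S → T → ℂ} (hc : Continuous fun p : S × T => h p.1 p.2)
    (C : ℝ) (hC : ∀ x y, ‖h x y‖ ≤ C) : Continuous fun y => cint ν fun x => h x y := by
  have hreg : ν.variation.Regular := hν
  set m := ν.variation with hm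
  have hcx : ∀ y, Continuous fun x => h x y := fun y => hc.comp (Continuous.prodMk_left y)
  have hi : ∀ y, Integrable (fun x => h x y) m := fun y =>
    integrable_of_continuous m (hcx y) C fun x => hC x y
  rw [continuous_iff_continuousAt]
  intro y₀
  rw [ContinuousAt, Metric.tendsto_nhds]
  intro ε hε
  set δ : ℝ := ε / (2 * (m.real univ + 1)) with hδ
  have hm0 : 0 ≤ m.real univ := measureReal_nonneg
  have hδ0 : 0 < δ := by positivity
  set η : ℝ := ε / (4 * (|C| + 1)) with hη
  have hη0 : 0 < η := by positivity
  obtain ⟨K, -, hK, hKlt⟩ := MeasurableSet.univ.exists_isCompact_sdiff_lt (measure_ne_top m univ)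
    (ε := ENNReal.ofReal η) (by simpa using hη0)
  let H : C(T, C(S, ℂ)) := ContinuousMap.curry ⟨fun p : T × S => h p.2 p.1, hc.comp continuous_swap⟩
  have hH : Tendsto H (𝓝 y₀) (𝓝 (H y₀)) := H.continuous.continuousAt
  have hu := ContinuousMap.tendsto_iff_forall_isCompact_tendstoUniformlyOn.1 hH K hK
  filter_upwards [Metric.tendstoUniformlyOn_iff.1 hu δ hδ0] with y hy
  have e : (cint ν fun x => h x y) - cint ν (fun x => h x y₀) = cint ν fun x => h x y - h x y₀ :=
    (VectorMeasure.integral_fun_sub (hi y) (hi y₀)).symm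
  rw [dist_eq_norm, e]
  refine (norm_cint_le _ _).trans_lt ?_
  have hKm : MeasurableSet K := hK.measurableSet
  have hint : Integrable (fun x => ‖h x y - h x y₀‖) m := ((hi y).sub (hi y₀)).norm
  have hb : ∀ x, ‖h x y - h x y₀‖ ≤ δ + Kᶜ.indicator (fun _ => 2 * |C|) x := by
    intro x
    by_cases hx : x ∈ K
    · have := hy x hx
      simp only [H, ContinuousMap.curry_apply, ContinuousMap.coe_mk] at this
      rw [dist_comm, dist_eq_norm] at this
      simpa [hx] using this.le
    · have h1 := norm_sub_le (h x y) (h x y₀)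
      have h2 := hC x y
      have h3 := hC x y₀
      have h4 := le_abs_self C
      simp only [indicator_of_mem (mem_compl hx)]
      linarith
  have hint2 : Integrable (Kᶜ.indicator fun _ : S => 2 * |C|) m :=
    (integrable_const _).indicator hKm.compl
  calc ∫ x, ‖h x y - h x y₀‖ ∂m ≤ ∫ x, (δ + Kᶜ.indicator (fun _ => 2 * |C|) x) ∂m :=
        integral_mono hint ((integrable_const _).add hint2) hb
    _ = m.real univ * δ + m.real Kᶜ * (2 * |C|) := by
        rw [integral_add (integrable_const _) hint2, integral_indicator_const _ hKm.compl]
        simp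
    _ ≤ m.real univ * δ + η * (2 * |C|) := by
        have : m.real Kᶜ ≤ η := by
          rw [compl_eq_univ_sdiff]
          exact ENNReal.toReal_le_of_le_ofReal hη0.le hKlt.le
        gcongr
    _ < ε := by
        have a1 : m.real univ * δ < ε / 2 := by
          rw [hδ, mul_div_assoc', div_lt_div_iff₀ (by positivity) (by positivity)]
          nlinarith
        have a2 : η * (2 * |C|) < ε / 2 := by
          have := abs_nonneg C
          rw [hη, div_mul_eq_mul_div, div_lt_div_iff₀ (by positivity) (by positivity)]
          nlinarith
        linarith

theorem norm_cint_le_of_bound (ν : ComplexMeasure S) {f : S → ℂ} (hf : Continuous f) (C : ℝ)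
    (hC : ∀ x, ‖f x‖ ≤ C) : ‖cint ν f‖ ≤ C * ν.variation.real univ := by
  refine (norm_cint_le ν f).trans ?_
  refine (integral_mono (integrable_of_continuous _ hf C hC).norm (integrable_const C) hC).trans ?_
  simp [mul_comm]

section Conv

variable [LocallyCompactSpace S] [Mul S] [ContinuousMul S]

theorem exists_conv_pos (m₁ m₂ : Measure S) [IsFiniteMeasure m₁] [IsFiniteMeasure m₂]
    [m₁.Regular] [m₂.Regular] {k : S → S → ℝ} (hk : Continuous fun p : S × S => k p.1 p.2)
    (hk0 : ∀ x y, 0 ≤ k x y) (hk1 : ∀ x y, k x y ≤ 1) :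
    ∃ ρ ∈ radonSubmodule S, ∀ f : C_c(S, ℂ), cint ρ f =
      cint (ofMeasure m₂) fun y => cint (ofMeasure m₁) fun x => k x y * f (x * y) := by
  have hcont : ∀ f : C_c(S, ℂ), Continuous fun p : S × S => (k p.1 p.2 : ℂ) * f (p.1 * p.2) := by
    intro f
    fun_prop
  have hbd : ∀ f : C_c(S, ℂ), ∀ C, (∀ x, ‖f x‖ ≤ C) → ∀ x y, ‖(k x y : ℂ) * f (x * y)‖ ≤ C := by
    intro f C hC x y
    rw [norm_mul, Complex.norm_real, Real.norm_of_nonneg (hk0 x y)]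
    exact (mul_le_of_le_one_left (norm_nonneg _) (hk1 x y)).trans (hC _)
  have hint1 : ∀ (f : C_c(S, ℂ)) y, Integrable (fun x => (k x y : ℂ) * f (x * y)) m₁ := by
    intro f y
    obtain ⟨C, hC⟩ := f.hasCompactSupport.exists_bound_of_continuous f.continuous
    exact integrable_of_continuous m₁ ((hcont f).comp (Continuous.prodMk_left y)) C
      fun x => hbd f C hC x y
  have hint2 : ∀ (f : C_c(S, ℂ)),
      Integrable (fun y => ∫ x, (k x y : ℂ) * f (x * y) ∂m₁) m₂ := by
    intro f
    obtain ⟨C, hC⟩ := f.hasCompactSupport.exists_bound_of_continuous f.continuous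
    have := continuous_cint (ofMeasure_mem m₁) (hcont f) C (hbd f C hC)
    simp only [cint_ofMeasure] at this
    refine integrable_of_continuous m₂ this (C * m₁.real univ) fun y => ?_
    have h2 := norm_cint_le_of_bound (ofMeasure m₁)
      ((hcont f).comp (Continuous.prodMk_left y)) C (fun x => hbd f C hC x y)
    simpa [cint_ofMeasure, variation_ofMeasure] using h2
  let toC : C_c(S, ℝ) → C_c(S, ℂ) := fun f => ⟨⟨fun x => (f x : ℂ), by fun_prop⟩,
      f.hasCompactSupport.comp_left (g := fun t : ℝ => (t : ℂ)) (by simp)⟩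
  have rint1 : ∀ (f : C_c(S, ℝ)) y, Integrable (fun x => k x y * f (x * y)) m₁ := by
    intro f y
    have := (hint1 (toC f) y).re
    simpa [toC] using this
  have rint2 : ∀ (f : C_c(S, ℝ)), Integrable (fun y => ∫ x, k x y * f (x * y) ∂m₁) m₂ := by
    intro f
    have := (hint2 (toC f)).re
    simp only [toC, CompactlySupportedContinuousMap.coe_mk, ContinuousMap.coe_mk,
      ← Complex.ofReal_mul, integral_complex_ofReal] at this
    simpa using this
  let L : C_c(S, ℝ) →ₗ[ℝ] ℝ :=
    { toFun := fun f => ∫ y, ∫ x, k x y * f (x * y) ∂m₁ ∂m₂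
      map_add' := fun f g => by
        rw [← integral_add (rint2 f) (rint2 g)]
        congr 1; ext y
        rw [← integral_add (rint1 f y) (rint1 g y)]
        simp [mul_add]
      map_smul' := fun c f => by
        simp only [CompactlySupportedContinuousMap.smul_apply, smul_eq_mul, RingHom.id_apply,
          mul_left_comm _ c, integral_const_mul] }
  let Λ : C_c(S, ℝ) →ₚ[ℝ] ℝ := PositiveLinearMap.mk₀ L fun f hf =>
    integral_nonneg fun y => integral_nonneg fun x => mul_nonneg (hk0 x y) (hf (x * y))
  have hΛ : ∀ f, Λ f = ∫ y, ∫ x, k x y * f (x * y) ∂m₁ ∂m₂ := fun f => rfl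
  set ρ := RealRMK.rieszMeasure Λ with hρ
  have hfin : IsFiniteMeasure ρ := by
    refine ⟨lt_of_le_of_lt (b := ENNReal.ofReal (m₁.real univ * m₂.real univ)) ?_
      ENNReal.ofReal_lt_top⟩
    rw [isOpen_univ.measure_eq_iSup_isCompact]
    refine iSup₂_le fun K _ => iSup_le fun hK => ?_
    obtain ⟨f, hf1, -, hfc, hf01⟩ := exists_continuous_one_zero_of_isCompact hK isClosed_empty
      (disjoint_empty K)
    let g : C_c(S, ℝ) := ⟨f, hfc⟩
    refine (RealRMK.rieszMeasure_le_of_eq_one Λ (f := g) (fun x => (hf01 x).1) hK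
      (fun x hx => hf1 hx)).trans (ENNReal.ofReal_le_ofReal ?_)
    rw [hΛ]
    have b1 : ∀ y, ∫ x, k x y * g (x * y) ∂m₁ ≤ m₁.real univ := fun y => by
      refine (integral_mono (rint1 g y) (integrable_const 1) fun x => ?_).trans (by simp)
      exact mul_le_one₀ (hk1 x y) (hf01 _).1 (hf01 _).2
    refine (integral_mono (rint2 g) (integrable_const _) b1).trans ?_
    simp [mul_comm]
  have hreg : ρ.Regular := RealRMK.regular_rieszMeasure Λ
  refine ⟨ofMeasure ρ, ofMeasure_mem ρ, fun f => ?_⟩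
  simp only [cint_ofMeasure]
  let re : C_c(S, ℝ) := ⟨⟨fun x => (f x).re, by fun_prop⟩,
      f.hasCompactSupport.comp_left (g := Complex.re) rfl⟩
  let im : C_c(S, ℝ) := ⟨⟨fun x => (f x).im, by fun_prop⟩,
      f.hasCompactSupport.comp_left (g := Complex.im) rfl⟩
  have e1 : ∫ x, re x ∂ρ = ∫ y, ∫ x, k x y * re (x * y) ∂m₁ ∂m₂ :=
    RealRMK.integral_rieszMeasure Λ re
  have e2 : ∫ x, im x ∂ρ = ∫ y, ∫ x, k x y * im (x * y) ∂m₁ ∂m₂ :=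
    RealRMK.integral_rieszMeasure Λ im
  have hre : ∀ {m : Measure S} {g : S → ℂ}, Integrable g m →
      (∫ x, g x ∂m).re = ∫ x, (g x).re ∂m := fun hg =>
    (Complex.reCLM.integral_comp_comm hg).symm
  have him : ∀ {m : Measure S} {g : S → ℂ}, Integrable g m →
      (∫ x, g x ∂m).im = ∫ x, (g x).im ∂m := fun hg =>
    (Complex.imCLM.integral_comp_comm hg).symm
  apply Complex.ext
  · rw [hre (integrable_cc ρ f), hre (hint2 f)]
    refine Eq.trans e1 ?_
    congr 1; ext y
    rw [hre (hint1 f y)]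
    simp [re]
  · rw [him (integrable_cc ρ f), him (hint2 f)]
    refine Eq.trans e2 ?_
    congr 1; ext y
    rw [him (hint1 f y)]
    simp [im]

theorem exists_conv {a b : ComplexMeasure S} (ha : a ∈ radonSubmodule S)
    (hb : b ∈ radonSubmodule S) {k : S → S → ℝ} (hk : Continuous fun p : S × S => k p.1 p.2)
    (hk0 : ∀ x y, 0 ≤ k x y) (hk1 : ∀ x y, k x y ≤ 1) :
    ∃ ρ ∈ radonSubmodule S, ∀ f : C_c(S, ℂ), cint ρ f =
      cint b fun y => cint a fun x => k x y * f (x * y) := by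
  have hcont : ∀ f : C_c(S, ℂ), Continuous fun p : S × S => (k p.1 p.2 : ℂ) * f (p.1 * p.2) := by
    intro f
    fun_prop
  have hbd : ∀ f : C_c(S, ℂ), ∃ C, ∀ x y, ‖(k x y : ℂ) * f (x * y)‖ ≤ C := by
    intro f
    obtain ⟨C, hC⟩ := f.hasCompactSupport.exists_bound_of_continuous f.continuous
    refine ⟨C, fun x y => ?_⟩
    rw [norm_mul, Complex.norm_real, Real.norm_of_nonneg (hk0 x y)]
    exact (mul_le_of_le_one_left (norm_nonneg _) (hk1 x y)).trans (hC _)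
  have hint1 : ∀ (f : C_c(S, ℂ)) y (ν : ComplexMeasure S),
      Integrable (fun x => (k x y : ℂ) * f (x * y)) ν.variation := by
    intro f y ν
    obtain ⟨C, hC⟩ := hbd f
    exact integrable_of_continuous _ ((hcont f).comp (Continuous.prodMk_left y)) C
      fun x => hC x y
  have hint2 : ∀ (f : C_c(S, ℂ)) (ν ν' : ComplexMeasure S), ν ∈ radonSubmodule S →
      Integrable (fun y => cint ν fun x => (k x y : ℂ) * f (x * y)) ν'.variation := by
    intro f ν ν' hν
    obtain ⟨C, hC⟩ := hbd f
    exact integrable_of_continuous _ (continuous_cint hν (hcont f) C hC) _ fun y =>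
      norm_cint_le_of_bound ν ((hcont f).comp (Continuous.prodMk_left y)) C (fun x => hC x y)
  revert b
  refine radon_induction (P := fun a => ∀ {b : ComplexMeasure S}, b ∈ radonSubmodule S →
    ∃ ρ ∈ radonSubmodule S, ∀ f : C_c(S, ℂ), cint ρ f =
      cint b fun y => cint a fun x => k x y * f (x * y)) ?_ ?_ ?_ ha
  · intro m₁ _ _ b hb
    refine radon_induction (P := fun b => ∃ ρ ∈ radonSubmodule S, ∀ f : C_c(S, ℂ), cint ρ f =
      cint b fun y => cint (ofMeasure m₁) fun x => k x y * f (x * y)) ?_ ?_ ?_ hb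
    · intro m₂ _ _
      exact exists_conv_pos m₁ m₂ hk hk0 hk1
    · rintro b _ b' _ ⟨ρ, hρ, e⟩ ⟨ρ', hρ', e'⟩
      refine ⟨ρ + ρ', Submodule.add_mem _ hρ hρ', fun f => ?_⟩
      rw [cint_add_measure (integrable_cc _ f) (integrable_cc _ f), e, e',
        cint_add_measure (hint2 f _ _ (ofMeasure_mem m₁)) (hint2 f _ _ (ofMeasure_mem m₁))]
    · rintro c b _ ⟨ρ, hρ, e⟩
      refine ⟨c • ρ, Submodule.smul_mem _ _ hρ, fun f => ?_⟩
      rw [cint_smul_measure _ (integrable_cc _ f), e,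
        cint_smul_measure _ (hint2 f _ _ (ofMeasure_mem m₁))]
  · intro a ha a' ha' h h' b hb
    obtain ⟨ρ, hρ, e⟩ := h hb
    obtain ⟨ρ', hρ', e'⟩ := h' hb
    refine ⟨ρ + ρ', Submodule.add_mem _ hρ hρ', fun f => ?_⟩
    rw [cint_add_measure (integrable_cc _ f) (integrable_cc _ f), e, e',
      ← cint_add (hint2 f _ _ ha) (hint2 f _ _ ha')]
    refine cint_congr fun y => ?_
    rw [cint_add_measure (hint1 f y _) (hint1 f y _)]
  · intro c a ha h b hb
    obtain ⟨ρ, hρ, e⟩ := h hb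
    refine ⟨c • ρ, Submodule.smul_mem _ _ hρ, fun f => ?_⟩
    rw [cint_smul_measure _ (integrable_cc _ f), e, ← cint_const_mul]
    refine cint_congr fun y => ?_
    rw [cint_smul_measure _ (hint1 f y _)]

end Conv

end Regular

section Definitions

variable (S : Type*) [TopologicalSpace S] [T2Space S] [MeasurableSpace S] [BorelSpace S]

/-- `M(S)`: the space of all bounded complex Radon measures on `S`. -/
def RadonMeasure : Type _ := ↥(radonSubmodule S)

namespace RadonMeasure

noncomputable instance : AddCommGroup (RadonMeasure S) :=
  inferInstanceAs (AddCommGroup ↥(radonSubmodule S))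

noncomputable instance : Module ℂ (RadonMeasure S) :=
  inferInstanceAs (Module ℂ ↥(radonSubmodule S))

variable {S}

/-- The underlying complex measure. -/
def toComplex (μ : RadonMeasure S) : ComplexMeasure S := Subtype.val μ

theorem toComplex_mem (μ : RadonMeasure S) : μ.toComplex ∈ radonSubmodule S := Subtype.property μ

theorem toComplex_add (μ ν : RadonMeasure S) :
    (μ + ν).toComplex = μ.toComplex + ν.toComplex := rfl

theorem toComplex_smul (c : ℂ) (μ : RadonMeasure S) : (c • μ).toComplex = c • μ.toComplex := rfl

theorem toComplex_zero : (0 : RadonMeasure S).toComplex = 0 := rfl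

theorem toComplex_injective : Function.Injective (toComplex (S := S)) := Subtype.val_injective

/-- The total variation `|μ|`. -/
noncomputable def tv (μ : RadonMeasure S) : Measure S := μ.toComplex.variation

instance (μ : RadonMeasure S) : IsFiniteMeasure μ.tv := isFiniteMeasure_variation _

instance (μ : RadonMeasure S) : μ.tv.Regular := μ.toComplex_mem

/-- The total variation norm `‖μ‖ = |μ|(S)`. -/
noncomputable instance : Norm (RadonMeasure S) := ⟨fun μ => μ.tv.real univ⟩

theorem norm_def (μ : RadonMeasure S) : ‖μ‖ = μ.tv.real univ := rfl

variable (S) in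
theorem core : NormedSpace.Core ℂ (RadonMeasure S) where
  norm_nonneg _ := measureReal_nonneg
  norm_smul c μ := by
    rw [norm_def, norm_def, tv, tv, toComplex_smul, VectorMeasure.variation_smul]
    simp [Measure.real]
  norm_triangle μ ν := by
    rw [norm_def, norm_def, norm_def, tv, tv, tv, toComplex_add, ← measureReal_add_apply]
    exact ENNReal.toReal_mono (measure_ne_top _ _) (VectorMeasure.variation_add_le univ)
  norm_eq_zero_iff μ := by
    rw [norm_def, Measure.real, ENNReal.toReal_eq_zero_iff]
    simp only [measure_ne_top, or_false, Measure.measure_univ_eq_zero, tv,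
      VectorMeasure.variation_eq_zero]
    exact ⟨fun h => toComplex_injective h, fun h => h ▸ rfl⟩

noncomputable instance : NormedAddCommGroup (RadonMeasure S) := NormedAddCommGroup.ofCore (core S)

noncomputable instance : NormedSpace ℂ (RadonMeasure S) := NormedSpace.ofCore (core S)

/-- A finite positive Radon measure as an element of `M(S)`. -/
noncomputable def ofRegular (m : Measure S) [IsFiniteMeasure m] (h : m.Regular) :
    RadonMeasure S := ⟨ofMeasure m, ofMeasure_mem m⟩

variable [Mul S] [ContinuousMul S]

/-- `δ_x * |μ|`, the image of `|μ|` under `y ↦ x y`. -/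
noncomputable def diracMulAbs (x : S) (μ : RadonMeasure S) : RadonMeasure S :=
  ofRegular (μ.tv.map (x * ·)) (regular_map inferInstance (continuous_const_mul x))

/-- `|μ| * δ_x`, the image of `|μ|` under `y ↦ y x`. -/
noncomputable def absMulDirac (μ : RadonMeasure S) (x : S) : RadonMeasure S :=
  ofRegular (μ.tv.map (· * x)) (regular_map inferInstance (continuous_mul_const x))

end RadonMeasure

variable [Mul S] [ContinuousMul S]

/-- `M_a(S)`: the measures `μ ∈ M(S)` for which `x ↦ δ_x * |μ|` and `x ↦ |μ| * δ_x` are continuous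
from `S` into `M(S)` with its weak topology `σ(M(S), M(S)')`. -/
def Ma : Set (RadonMeasure S) :=
  {μ | Continuous (fun x : S => toWeakSpace ℂ (RadonMeasure S) (RadonMeasure.diracMulAbs x μ)) ∧
    Continuous (fun x : S => toWeakSpace ℂ (RadonMeasure S) (RadonMeasure.absMulDirac μ x))}

/-- `S` is a foundation semigroup: the supports of the measures in `M_a(S)` have dense union. -/
def IsFoundation : Prop := closure (⋃ μ ∈ Ma S, μ.tv.support) = univ

end Definitions

/-- A weight function: continuous, positive and submultiplicative. (Continuity and positivity give
that `ω` and `1/ω` are bounded on compact sets; conversely `1/ω` makes sense only if `ω > 0`.) -/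
structure Weight (S : Type*) [TopologicalSpace S] [Mul S] where
  /-- the underlying function -/
  toFun : S → ℝ
  continuous_toFun : Continuous toFun
  pos : ∀ x, 0 < toFun x
  submul : ∀ x y, toFun (x * y) ≤ toFun x * toFun y

instance (S : Type*) [TopologicalSpace S] [Mul S] : CoeFun (Weight S) fun _ => S → ℝ :=
  ⟨Weight.toFun⟩

section Weighted

variable {S : Type*} [TopologicalSpace S] [T2Space S] [MeasurableSpace S] [BorelSpace S] [Mul S]

theorem Weight.continuous (ω : Weight S) : Continuous ω := ω.continuous_toFun

theorem Weight.ne_zero (ω : Weight S) (x : S) : (ω x : ℂ) ≠ 0 := by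
  exact_mod_cast (ω.pos x).ne'

theorem Weight.continuous_inv (ω : Weight S) : Continuous fun x => ((ω x : ℂ))⁻¹ :=
  (Complex.continuous_ofReal.comp ω.continuous).inv₀ ω.ne_zero

/-- The product `ω f` for `f ∈ C_c(S)`. -/
noncomputable def Weight.mul (ω : Weight S) (f : C_c(S, ℂ)) : C_c(S, ℂ) :=
  ⟨⟨fun x => ω x * f x, (Complex.continuous_ofReal.comp ω.continuous).mul f.continuous⟩,
    f.hasCompactSupport.mul_left⟩

/-- The quotient `f / ω` for `f ∈ C_c(S)`. -/
noncomputable def Weight.div (ω : Weight S) (f : C_c(S, ℂ)) : C_c(S, ℂ) :=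
  ⟨⟨fun x => (ω x : ℂ)⁻¹ * f x, ω.continuous_inv.mul f.continuous⟩, f.hasCompactSupport.mul_left⟩

theorem Weight.mul_apply (ω : Weight S) (f : C_c(S, ℂ)) (x : S) : ω.mul f x = ω x * f x := rfl

theorem Weight.div_apply (ω : Weight S) (f : C_c(S, ℂ)) (x : S) :
    ω.div f x = (ω x : ℂ)⁻¹ * f x := rfl

theorem Weight.mul_div (ω : Weight S) (f : C_c(S, ℂ)) : ω.mul (ω.div f) = f := by
  ext x
  rw [ω.mul_apply, ω.div_apply, mul_inv_cancel_left₀ (ω.ne_zero x)]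

theorem Weight.div_mul (ω : Weight S) (f : C_c(S, ℂ)) : ω.div (ω.mul f) = f := by
  ext x
  rw [ω.div_apply, ω.mul_apply, inv_mul_cancel_left₀ (ω.ne_zero x)]

/-- A complex Radon measure `μ` is a linear functional on `C_c(S)` that is bounded on the functions
supported in any fixed compact set (`μ` may be unbounded, so need not be defined on all Borel sets).
`ω μ` is the functional `f ↦ μ(ω f)`; it lies in `M(S)` when it is integration against a bounded
complex Radon measure `ν`. (The local boundedness of `μ` follows, as `1/ω` is bounded on compact
sets; see `WeightedMeasure.exists_bound`.) -/
noncomputable def weightedSubmodule (ω : Weight S) : Submodule ℂ (C_c(S, ℂ) →ₗ[ℂ] ℂ) where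
  carrier := {μ | ∃ ν : RadonMeasure S, ∀ f : C_c(S, ℂ), μ (ω.mul f) = cint ν.toComplex f}
  zero_mem' := ⟨0, fun f => by
    simp [RadonMeasure.toComplex_zero, cint]⟩
  add_mem' := by
    rintro μ μ' ⟨ν, h⟩ ⟨ν', h'⟩
    refine ⟨ν + ν', fun f => ?_⟩
    rw [RadonMeasure.toComplex_add, cint_add_measure (integrable_cc _ f) (integrable_cc _ f), ← h,
      ← h', LinearMap.add_apply]
  smul_mem' := by
    rintro c μ ⟨ν, h⟩
    refine ⟨c • ν, fun f => ?_⟩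
    rw [RadonMeasure.toComplex_smul, cint_smul_measure _ (integrable_cc _ f), ← h,
      LinearMap.smul_apply, smul_eq_mul]

/-- `M(S,ω)`: the complex Radon measures `μ` on `S` with `ω μ ∈ M(S)`. -/
def WeightedMeasure (ω : Weight S) : Type _ := ↥(weightedSubmodule ω)

namespace WeightedMeasure

variable {ω : Weight S}

noncomputable instance : AddCommGroup (WeightedMeasure ω) :=
  inferInstanceAs (AddCommGroup ↥(weightedSubmodule ω))

noncomputable instance : Module ℂ (WeightedMeasure ω) :=
  inferInstanceAs (Module ℂ ↥(weightedSubmodule ω))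

/-- `μ(f) = ∫ f dμ` for `f ∈ C_c(S)`. -/
def toFunctional (μ : WeightedMeasure ω) : C_c(S, ℂ) →ₗ[ℂ] ℂ := Subtype.val μ

theorem toFunctional_injective : Function.Injective (toFunctional (ω := ω)) :=
  Subtype.val_injective

theorem toFunctional_add (μ ν : WeightedMeasure ω) :
    (μ + ν).toFunctional = μ.toFunctional + ν.toFunctional := rfl

theorem toFunctional_smul (c : ℂ) (μ : WeightedMeasure ω) :
    (c • μ).toFunctional = c • μ.toFunctional := rfl

/-- The bounded measure `ω μ ∈ M(S)`. -/
noncomputable def weighted (μ : WeightedMeasure ω) : RadonMeasure S :=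
  Classical.choose (Subtype.property μ)

theorem weighted_spec (μ : WeightedMeasure ω) (f : C_c(S, ℂ)) :
    μ.toFunctional (ω.mul f) = cint μ.weighted.toComplex f :=
  Classical.choose_spec (Subtype.property μ) f

variable [LocallyCompactSpace S]

theorem eq_weighted {μ : WeightedMeasure ω} {ν : RadonMeasure S}
    (h : ∀ f : C_c(S, ℂ), μ.toFunctional (ω.mul f) = cint ν.toComplex f) : μ.weighted = ν := by
  have := eq_zero_of_cint (μ.weighted + (-1 : ℂ) • ν).toComplex_mem fun f => by
    rw [RadonMeasure.toComplex_add, RadonMeasure.toComplex_smul,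
      cint_add_measure (integrable_cc _ f) (integrable_cc _ f),
      cint_smul_measure _ (integrable_cc _ f), ← weighted_spec, ← h]
    ring
  have h2 : μ.weighted + (-1 : ℂ) • ν = 0 := RadonMeasure.toComplex_injective this
  rwa [neg_one_smul, add_neg_eq_zero] at h2

variable (ω) in
/-- `μ ↦ ω μ` as a linear map from `M(S,ω)` to `M(S)`. -/
noncomputable def weightedₗ : WeightedMeasure ω →ₗ[ℂ] RadonMeasure S where
  toFun := weighted
  map_add' μ ν := eq_weighted fun f => by
    rw [toFunctional_add, LinearMap.add_apply, weighted_spec, weighted_spec,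
      RadonMeasure.toComplex_add, cint_add_measure (integrable_cc _ f) (integrable_cc _ f)]
  map_smul' c μ := eq_weighted fun f => by
    rw [toFunctional_smul, LinearMap.smul_apply, weighted_spec, RingHom.id_apply,
      RadonMeasure.toComplex_smul, cint_smul_measure _ (integrable_cc _ f), smul_eq_mul]

theorem weighted_add (μ ν : WeightedMeasure ω) : (μ + ν).weighted = μ.weighted + ν.weighted :=
  (weightedₗ ω).map_add μ ν

theorem weighted_smul (c : ℂ) (μ : WeightedMeasure ω) : (c • μ).weighted = c • μ.weighted :=
  (weightedₗ ω).map_smul c μ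

theorem weighted_injective : Function.Injective (weightedₗ ω) := fun μ ν h => by
  apply toFunctional_injective
  ext f
  have h' : μ.weighted = ν.weighted := h
  rw [← ω.mul_div f, weighted_spec, weighted_spec, h']

/-- The norm `‖μ‖_ω = ‖ω μ‖ = ∫ ω d|μ|`. -/
noncomputable instance : NormedAddCommGroup (WeightedMeasure ω) :=
  NormedAddCommGroup.induced _ _ (weightedₗ ω) weighted_injective

noncomputable instance : NormedSpace ℂ (WeightedMeasure ω) :=
  NormedSpace.induced ℂ _ _ (weightedₗ ω)

theorem norm_def (μ : WeightedMeasure ω) : ‖μ‖ = ‖μ.weighted‖ := rfl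

/-- The integral `∫ g dμ` of a function `g` against `μ ∈ M(S,ω)`, that is `∫ (g/ω) d(ωμ)`. -/
noncomputable def integral (μ : WeightedMeasure ω) (g : S → ℂ) : ℂ :=
  cint μ.weighted.toComplex fun x => (ω x : ℂ)⁻¹ * g x

theorem integral_cc (μ : WeightedMeasure ω) (f : C_c(S, ℂ)) : μ.integral f = μ.toFunctional f := by
  conv_rhs => rw [← ω.mul_div f, weighted_spec]
  rfl

theorem toFunctional_apply (μ : WeightedMeasure ω) (f : C_c(S, ℂ)) :
    μ.toFunctional f = cint μ.weighted.toComplex (ω.div f) := by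
  conv_lhs => rw [← ω.mul_div f, weighted_spec]

/-- Every `μ ∈ M(S,ω)` is indeed a Radon measure: it is bounded on the functions supported in a
fixed compact set. -/
theorem exists_bound (μ : WeightedMeasure ω) {K : Set S} (hK : IsCompact K) :
    ∃ C : ℝ, ∀ (f : C_c(S, ℂ)) (M : ℝ), (∀ x, x ∉ K → f x = 0) → (∀ x, ‖f x‖ ≤ M) →
      ‖μ.toFunctional f‖ ≤ C * M := by
  obtain ⟨D, hD⟩ := hK.exists_bound_of_continuousOn ω.continuous_inv.continuousOn
  refine ⟨|D| * μ.weighted.toComplex.variation.real univ, fun f M hf hM => ?_⟩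
  rw [toFunctional_apply, mul_right_comm]
  refine norm_cint_le_of_bound _ (ω.div f).continuous _ fun x => ?_
  change ‖(ω x : ℂ)⁻¹ * f x‖ ≤ |D| * M
  rw [norm_mul]
  have hM0 : 0 ≤ M := (norm_nonneg _).trans (hM x)
  by_cases hx : x ∈ K
  · exact mul_le_mul ((hD x hx).trans (le_abs_self D)) (hM x) (norm_nonneg _) (abs_nonneg D)
  · rw [hf x hx, norm_zero, mul_zero]
    positivity

variable [ContinuousMul S]

theorem conv_kernel (μ ν : WeightedMeasure ω) (f : C_c(S, ℂ)) :
    (ν.integral fun y => μ.integral fun x => f (x * y)) =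
      cint ν.weighted.toComplex fun y => cint μ.weighted.toComplex fun x =>
        ((ω (x * y) / (ω x * ω y) : ℝ) : ℂ) * ω.div f (x * y) := by
  refine cint_congr fun y => ?_
  refine (cint_const_mul _ _ _).symm.trans ?_
  refine cint_congr fun x => ?_
  have h1 := ω.ne_zero x
  have h2 := ω.ne_zero y
  have h3 := ω.ne_zero (x * y)
  rw [ω.div_apply]
  push_cast
  field_simp

theorem continuous_kernel : Continuous fun p : S × S => ω (p.1 * p.2) / (ω p.1 * ω p.2) := by
  have := ω.continuous
  refine Continuous.div₀ (by fun_prop) (by fun_prop) fun p => ?_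
  exact (mul_pos (ω.pos _) (ω.pos _)).ne'

theorem kernel_nonneg (x y : S) : 0 ≤ ω (x * y) / (ω x * ω y) :=
  (div_pos (ω.pos _) (mul_pos (ω.pos _) (ω.pos _))).le

theorem kernel_le_one (x y : S) : ω (x * y) / (ω x * ω y) ≤ 1 :=
  (div_le_one (mul_pos (ω.pos _) (ω.pos _))).2 (ω.submul x y)

theorem exists_conv (μ ν : WeightedMeasure ω) : ∃ ρ : RadonMeasure S, ∀ f : C_c(S, ℂ),
    (ν.integral fun y => μ.integral fun x => f (x * y)) = cint ρ.toComplex (ω.div f) := by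
  obtain ⟨ρ, hρ, h⟩ := FoundationSemigroup.exists_conv μ.weighted.toComplex_mem
    ν.weighted.toComplex_mem continuous_kernel (kernel_nonneg (ω := ω)) kernel_le_one
  exact ⟨⟨ρ, hρ⟩, fun f => by rw [conv_kernel, ← h]; rfl⟩

/-- The convolution `(μ * ν)(f) = ∫ ∫ f(xy) dμ(x) dν(y)`, `f ∈ C_c(S)`. -/
noncomputable def conv (μ ν : WeightedMeasure ω) : WeightedMeasure ω :=
  ⟨{ toFun := fun f => ν.integral fun y => μ.integral fun x => f (x * y)
     map_add' := fun f g => by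
       obtain ⟨ρ, h⟩ := exists_conv μ ν
       rw [h, h, h, ← cint_add (integrable_cc _ _) (integrable_cc _ _)]
       exact cint_congr fun x => by simp [ω.div_apply, mul_add]
     map_smul' := fun c f => by
       obtain ⟨ρ, h⟩ := exists_conv μ ν
       rw [h, h, RingHom.id_apply, smul_eq_mul, ← cint_const_mul]
       exact cint_congr fun x => by simp [ω.div_apply, mul_left_comm] },
   by
    obtain ⟨ρ, h⟩ := exists_conv μ ν
    refine ⟨ρ, fun f => ?_⟩
    exact (h (ω.mul f)).trans (by rw [ω.div_mul])⟩

noncomputable instance : Mul (WeightedMeasure ω) := ⟨conv⟩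

theorem mul_toFunctional (μ ν : WeightedMeasure ω) (f : C_c(S, ℂ)) :
    (μ * ν).toFunctional f = ν.integral fun y => μ.integral fun x => f (x * y) := rfl

variable (ω) in
/-- Convolution as a bilinear map. -/
noncomputable def convₗ :
    WeightedMeasure ω →ₗ[ℂ] WeightedMeasure ω →ₗ[ℂ] WeightedMeasure ω := by
  have hcont : ∀ f : C_c(S, ℂ), Continuous fun p : S × S =>
      ((ω (p.1 * p.2) / (ω p.1 * ω p.2) : ℝ) : ℂ) * ω.div f (p.1 * p.2) := fun f =>
    (Complex.continuous_ofReal.comp continuous_kernel).mul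
      ((ω.div f).continuous.comp continuous_mul)
  have hbd : ∀ f : C_c(S, ℂ), ∃ C, ∀ x y,
      ‖((ω (x * y) / (ω x * ω y) : ℝ) : ℂ) * ω.div f (x * y)‖ ≤ C := by
    intro f
    obtain ⟨C, hC⟩ := (ω.div f).hasCompactSupport.exists_bound_of_continuous (ω.div f).continuous
    refine ⟨C, fun x y => ?_⟩
    rw [norm_mul, Complex.norm_real, Real.norm_of_nonneg (kernel_nonneg x y)]
    exact (mul_le_of_le_one_left (norm_nonneg _) (kernel_le_one x y)).trans (hC _)
  have i1 : ∀ (f : C_c(S, ℂ)) (y : S) (a : RadonMeasure S), Integrable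
      (fun x => ((ω (x * y) / (ω x * ω y) : ℝ) : ℂ) * ω.div f (x * y)) a.toComplex.variation := by
    intro f y a
    obtain ⟨C, hC⟩ := hbd f
    exact integrable_of_continuous _ ((hcont f).comp (Continuous.prodMk_left y)) C
      fun x => hC x y
  have i2 : ∀ (f : C_c(S, ℂ)) (a b : RadonMeasure S), Integrable (fun y => cint a.toComplex
      fun x => ((ω (x * y) / (ω x * ω y) : ℝ) : ℂ) * ω.div f (x * y)) b.toComplex.variation := by
    intro f a b
    obtain ⟨C, hC⟩ := hbd f
    exact integrable_of_continuous _ (continuous_cint a.toComplex_mem (hcont f) C hC) _ fun y =>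
      norm_cint_le_of_bound _ ((hcont f).comp (Continuous.prodMk_left y)) C (fun x => hC x y)
  refine LinearMap.mk₂ ℂ (fun μ ν => μ * ν) ?_ ?_ ?_ ?_
  · intro μ μ' ν
    apply toFunctional_injective
    ext f
    rw [toFunctional_add, LinearMap.add_apply, mul_toFunctional, mul_toFunctional, mul_toFunctional,
      conv_kernel, conv_kernel, conv_kernel, ← cint_add (i2 f _ _) (i2 f _ _)]
    refine cint_congr fun y => ?_
    rw [weighted_add, RadonMeasure.toComplex_add, cint_add_measure (i1 f y _) (i1 f y _)]
  · intro c μ ν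
    apply toFunctional_injective
    ext f
    rw [toFunctional_smul, LinearMap.smul_apply, mul_toFunctional, mul_toFunctional,
      conv_kernel, conv_kernel, smul_eq_mul, ← cint_const_mul]
    refine cint_congr fun y => ?_
    rw [weighted_smul, RadonMeasure.toComplex_smul, cint_smul_measure _ (i1 f y _)]
  · intro μ ν ν'
    apply toFunctional_injective
    ext f
    rw [toFunctional_add, LinearMap.add_apply, mul_toFunctional, mul_toFunctional, mul_toFunctional,
      conv_kernel, conv_kernel, conv_kernel, weighted_add, RadonMeasure.toComplex_add,
      cint_add_measure (i2 f _ _) (i2 f _ _)]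
  · intro c μ ν
    apply toFunctional_injective
    ext f
    rw [toFunctional_smul, LinearMap.smul_apply, mul_toFunctional, mul_toFunctional,
      conv_kernel, conv_kernel, weighted_smul, RadonMeasure.toComplex_smul,
      cint_smul_measure _ (i2 f _ _), smul_eq_mul]

theorem convₗ_apply (μ ν : WeightedMeasure ω) : convₗ ω μ ν = μ * ν := rfl

/-- `M_a(S,ω)`: the measures `μ ∈ M(S,ω)` with `ω μ ∈ M_a(S)`. -/
def Ma (ω : Weight S) : Set (WeightedMeasure ω) := {μ | μ.weighted ∈ FoundationSemigroup.Ma S}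

/-- `ℓ¹(S,ω)` inside `M(S,ω)`: the discrete measures `∑ c(x) δ_x` with `∑ |c(x)| ω(x) < ∞`. -/
def l1 (ω : Weight S) : Set (WeightedMeasure ω) :=
  {μ | ∃ c : S → ℂ, Summable (fun x => ‖c x‖ * ω x) ∧
    ∀ f : C_c(S, ℂ), HasSum (fun x => c x * f x) (μ.toFunctional f)}

/-- The seminorm `p_ν(μ) = ‖μ * ν‖ + ‖ν * μ‖`. -/
noncomputable def strictSeminorm (ν : WeightedMeasure ω) : Seminorm ℂ (WeightedMeasure ω) :=
  (normSeminorm ℂ (WeightedMeasure ω)).comp ((convₗ ω).flip ν) +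
    (normSeminorm ℂ (WeightedMeasure ω)).comp (convₗ ω ν)

theorem strictSeminorm_apply (ν μ : WeightedMeasure ω) :
    strictSeminorm ν μ = ‖μ * ν‖ + ‖ν * μ‖ := rfl

/-- The strict topology (so) on `M(S,ω)`, defined by the seminorms `p_ν`, `ν ∈ M_a(S,ω)`. -/
@[reducible]
noncomputable def strictTopology (ω : Weight S) : TopologicalSpace (WeightedMeasure ω) :=
  (SeminormFamily.moduleFilterBasis (𝕜 := ℂ) (F := WeightedMeasure ω)
    fun ν : Ma ω => strictSeminorm (ν : WeightedMeasure ω)).topology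

end WeightedMeasure

end Weighted

end FoundationSemigroup

/-! A strict neighbourhood involves only finitely many `ν i` in `M_a(S,ω)`, so it suffices to
approximate the finite tuple of convolutions of `μ` with the `ν i`, on either side, in the norm of a
finite power of `M(S)`, by tuples coming from combinations of point masses. By Hahn–Banach this
reduces to the following: if functionals `F i` on `M(S)` satisfy `∑ F i (ω (δ_x * ν i)) = 0` for
every `x` (with the factors in the other order where required), then the same sum with `μ` in place
of `δ_x` is zero (`sum_functional_eq_zero`).

Formally one integrates the hypothesis against `μ`, but an element of the dual of `M(S)` is not a
function on `S`, and `F (μ * ν) = ∫ F (δ_x * ν) dμ(x)` needs an argument. Write `a = ω μ` and `b = ω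
ν`. The point is that one finite Radon measure, the convolution of `|a|` and `|b|`, dominates all
translates `δ_x * |b|` with `x` in the support of `a` (`exists_dominating_measure`). Indeed, if it
vanishes on a compact `E`, then `x ↦ (δ_x * |b|)(E)` has zero `|a|`-integral; this function is
nonnegative, and continuous because `ω ν` lies in `M_a(S)`, so it vanishes on the support.

On the measures absolutely continuous with respect to a fixed finite Radon measure, `F` is
integration of a bounded function, which is an almost everywhere limit of a bounded sequence in
`C_c(S)` (`exists_dual_seq`). For functions in `C_c(S)` the interchange is Fubini's theorem, and
dominated convergence carries it to `F` (`exists_seq_tendsto_functional`). The weight enters only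
through the kernel `ω(xy)/(ω(x)ω(y)) ≤ 1`, which turns weighted convolution into an integral against
the bounded measures `a` and `b`. -/

namespace FoundationSemigroup

/-! ### Complex measures: densities and bounded convergence. -/

section ComplexMeasure

variable {S : Type*} [MeasurableSpace S]

theorem cint_sub {ν : ComplexMeasure S} {f g : S → ℂ} (hf : Integrable f ν.variation)
    (hg : Integrable g ν.variation) : cint ν (fun x => f x - g x) = cint ν f - cint ν g :=
  VectorMeasure.integral_fun_sub hf hg

theorem cint_indicator (ν : ComplexMeasure S) {A : Set S} (hA : MeasurableSet A) :
    cint ν (A.indicator fun _ => 1) = ν A := by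
  rw [cint, VectorMeasure.integral_eq_setToFun,
    setToFun_indicator_const _ hA (measure_ne_top _ _)]
  simp [VectorMeasure.transpose]

/-- Measurable subsets of an `m`-null set are `m`-null, so `ν` vanishes on all of them, and the
variation of the set is computed from these values. -/
theorem variation_absolutelyContinuous {ν : ComplexMeasure S} {m : Measure S}
    (h : ∀ A, MeasurableSet A → m A = 0 → ν A = 0) : ν.variation ≪ m := by
  refine Measure.AbsolutelyContinuous.mk fun A hA h0 => ?_
  rw [VectorMeasure.variation_apply_eq_zero hA]
  exact fun B hB hBm => h B hBm (measure_mono_null hB h0)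

/-- The Radon-Nikodym theorem for complex measures. -/
theorem exists_density {ν : ComplexMeasure S} {m : Measure S} [IsFiniteMeasure m]
    (h : ν.variation ≪ m) : ∃ g : S → ℂ, Integrable g m ∧ ν = m.withDensityᵥ g := by
  have hac : ∀ A, MeasurableSet A → m A = 0 → ν A = 0 := fun A hA h0 => by
    have h1 := VectorMeasure.enorm_measure_le_variation ν A
    rw [h h0] at h1
    simpa using h1
  have hre : m.withDensityᵥ ((ComplexMeasure.re ν).rnDeriv m) = ComplexMeasure.re ν := by
    refine SignedMeasure.withDensityᵥ_rnDeriv_eq _ _ (VectorMeasure.AbsolutelyContinuous.mk ?_)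
    intro A hA h0
    rw [Measure.toENNRealVectorMeasure_apply_measurable hA] at h0
    change (ν A).re = 0
    rw [hac A hA h0, Complex.zero_re]
  have him : m.withDensityᵥ ((ComplexMeasure.im ν).rnDeriv m) = ComplexMeasure.im ν := by
    refine SignedMeasure.withDensityᵥ_rnDeriv_eq _ _ (VectorMeasure.AbsolutelyContinuous.mk ?_)
    intro A hA h0
    rw [Measure.toENNRealVectorMeasure_apply_measurable hA] at h0
    change (ν A).im = 0
    rw [hac A hA h0, Complex.zero_im]
  refine ⟨ν.rnDeriv m, ν.integrable_rnDeriv m, ?_⟩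
  ext A hA
  have hi := (ν.integrable_rnDeriv m).integrableOn (s := A)
  rw [withDensityᵥ_apply (ν.integrable_rnDeriv m) hA]
  apply Complex.ext
  · rw [show (∫ x in A, ν.rnDeriv m x ∂m).re = ∫ x in A, (ν.rnDeriv m x).re ∂m from
      (Complex.reCLM.integral_comp_comm hi).symm]
    have := congrArg (fun s : SignedMeasure S => s A) hre
    rw [withDensityᵥ_apply (SignedMeasure.integrable_rnDeriv _ _) hA] at this
    exact this.symm
  · rw [show (∫ x in A, ν.rnDeriv m x ∂m).im = ∫ x in A, (ν.rnDeriv m x).im ∂m from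
      (Complex.imCLM.integral_comp_comm hi).symm]
    have := congrArg (fun s : SignedMeasure S => s A) him
    rw [withDensityᵥ_apply (SignedMeasure.integrable_rnDeriv _ _) hA] at this
    exact this.symm

theorem tendsto_cint {ν : ComplexMeasure S} {F : ℕ → S → ℂ} {f : S → ℂ} (C : ℝ)
    (hF : ∀ n, AEStronglyMeasurable (F n) ν.variation) (hC : ∀ n x, ‖F n x‖ ≤ C)
    (h : ∀ᵐ x ∂ν.variation, Tendsto (fun n => F n x) atTop (𝓝 (f x))) :
    Tendsto (fun n => cint ν (F n)) atTop (𝓝 (cint ν f)) :=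
  VectorMeasure.tendsto_integral_of_dominated_convergence (fun _ => C) hF
    (integrable_const C) (fun n => Eventually.of_forall (hC n)) h

end ComplexMeasure

/-! ### Radon measures: approximation by `C_c(S)`, absolute continuity, Fubini. -/

section Regular

variable {S : Type*} [TopologicalSpace S] [T2Space S] [MeasurableSpace S] [BorelSpace S]

/-- Absolute continuity of the integral: a compact `K ⊆ A` with `m (A \ K)` small also leaves little
of `∫ ‖g‖` outside `K`. -/
theorem regular_withDensity {m : Measure S} [IsFiniteMeasure m] [m.Regular] {g : S → ℂ}
    (hg : Integrable g m) : (m.withDensity fun x => ‖g x‖ₑ).Regular := by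
  have hfin : ∫⁻ x, ‖g x‖ₑ ∂m ≠ ∞ := hg.2.ne
  have : IsFiniteMeasure (m.withDensity fun x => ‖g x‖ₑ) := isFiniteMeasure_withDensity hfin
  set ρ := m.withDensity fun x => ‖g x‖ₑ with hρd
  have : ρ.InnerRegularCompactLTTop := by
    constructor
    rintro A ⟨hA, hA'⟩ r hr
    obtain ⟨δ, hδ, hδA⟩ := exists_pos_setLIntegral_lt_of_measure_lt hfin
      (ε := ρ A - r) (tsub_pos_of_lt hr).ne'
    obtain ⟨K, hKA, hK, hlt⟩ := hA.exists_isCompact_sdiff_lt (measure_ne_top m A) hδ.ne'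
    refine ⟨K, hKA, hK, ?_⟩
    by_contra! hle
    have h1 : ρ A ≤ ρ K + ρ (A \ K) := by
      rw [measure_add_sdiff hK.nullMeasurableSet]
      exact measure_mono subset_union_right
    have h2 : ρ (A \ K) < ρ A - r := by
      rw [hρd, withDensity_apply _ (hA.diff hK.measurableSet)]
      exact hδA _ hlt
    have h3 : ρ A < r + (ρ A - r) :=
      h1.trans_lt (ENNReal.add_lt_add_of_le_of_lt (measure_ne_top _ _) hle h2)
    rw [add_tsub_cancel_of_le hr.le] at h3
    exact h3.false
  infer_instance

/-- An absolutely continuous measure `h m` as an element of `M(S)`. -/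
theorem exists_radonMeasure_withDensity {m : Measure S} [IsFiniteMeasure m] [m.Regular] {h : S → ℂ}
    (hh : Integrable h m) : ∃ l : RadonMeasure S, l.toComplex = m.withDensityᵥ h := by
  refine ⟨⟨m.withDensityᵥ h, ?_⟩, rfl⟩
  change (m.withDensityᵥ h).variation.Regular
  rw [Measure.variation_withDensityᵥ hh]
  exact regular_withDensity hh

theorem norm_eq_of_withDensity {m : Measure S} [IsFiniteMeasure m] {h : S → ℂ}
    (hh : Integrable h m) {l : RadonMeasure S} (hl : l.toComplex = m.withDensityᵥ h) :
    ‖l‖ = ∫ x, ‖h x‖ ∂m := by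
  rw [RadonMeasure.norm_def, RadonMeasure.tv, hl, Measure.variation_withDensityᵥ hh, Measure.real,
    withDensity_apply _ MeasurableSet.univ, Measure.restrict_univ,
    integral_norm_eq_lintegral_enorm hh.1]

variable [LocallyCompactSpace S]

/-- Functions in `C_c(S)` approximating the indicator of a compact set from above. -/
theorem exists_cc_approx (m : Measure S) [IsFiniteMeasure m] [m.Regular] {E : Set S}
    (hE : IsCompact E) {ε : ℝ} (hε : 0 < ε) : ∃ φ : C_c(S, ℂ), ∃ r : C(S, ℝ),
      (∀ x, φ x = r x) ∧ (∀ x, r x ∈ Icc (0 : ℝ) 1) ∧ (∀ x ∈ E, r x = 1) ∧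
      ∫ x, ‖φ x - E.indicator (fun _ => 1) x‖ ∂m ≤ ε := by
  obtain ⟨U, hEU, hU, hlt⟩ := hE.exists_isOpen_lt_add (μ := m) (ε := ENNReal.ofReal ε)
    (by simpa using hε)
  obtain ⟨r, hr1, hr0, hrc, hr01⟩ := exists_continuous_one_zero_of_isCompact hE
    hU.isClosed_compl (disjoint_compl_right_iff_subset.2 hEU)
  let φ : C_c(S, ℂ) := ⟨⟨fun x => (r x : ℂ), by fun_prop⟩,
      hrc.comp_left (g := fun t : ℝ => (t : ℂ)) (by simp)⟩
  have hφ : ∀ x, φ x = r x := fun x => rfl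
  refine ⟨φ, r, hφ, hr01, hr1, ?_⟩
  have hEm := hE.measurableSet
  -- `φ` is the indicator of `E` both on `E` and off `U`; the error lives on `U \ E`, which has
  -- measure at most `ε`.
  have hb : ∀ x, ‖φ x - E.indicator (fun _ => 1) x‖ ≤ (U \ E).indicator (fun _ => (1 : ℝ)) x := by
    intro x
    by_cases hx : x ∈ E
    · simp [hx, hφ, hr1 hx]
    · by_cases hxU : x ∈ U
      · simp only [hφ, hx, not_false_eq_true, indicator_of_notMem, sub_zero, Complex.norm_real,
          Set.mem_sdiff, hxU, and_self, indicator_of_mem]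
        rw [Real.norm_of_nonneg (hr01 x).1]
        exact (hr01 x).2
      · simp [hx, hxU, hφ, hr0 (mem_compl hxU)]
  have hi : Integrable (fun x => φ x - E.indicator (fun _ => (1 : ℂ)) x) m :=
    (integrable_cc m φ).sub ((integrable_const 1).indicator hEm)
  have hd : MeasurableSet (U \ E) := hU.measurableSet.diff hEm
  refine (integral_mono hi.norm ((integrable_const (1 : ℝ)).indicator hd) hb).trans ?_
  rw [integral_indicator_const _ hd, smul_eq_mul, mul_one]
  refine ENNReal.toReal_le_of_le_ofReal hε.le ?_
  rw [measure_sdiff hEU hEm.nullMeasurableSet (measure_ne_top _ _)]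
  exact tsub_le_iff_left.2 hlt.le

/-- Absolute continuity of Radon measures can be tested on `C_c(S)`. -/
theorem absolutelyContinuous_of_cint_le {l : ComplexMeasure S} (hl : l ∈ radonSubmodule S)
    {κ : Measure S} [IsFiniteMeasure κ] [κ.Regular] {C : ℝ} (hC0 : 0 ≤ C)
    (hC : ∀ φ : C_c(S, ℂ), ‖cint l φ‖ ≤ C * ∫ x, ‖φ x‖ ∂κ) : l.variation ≪ κ := by
  have hreg : l.variation.Regular := hl
  have hcomp : ∀ E, IsCompact E → κ E = 0 → l E = 0 := by
    intro E hE h0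
    rw [← norm_le_zero_iff]
    refine le_of_forall_pos_le_add fun ε hε => ?_
    -- Approximating in the sum of the two measures makes one `φ` serve both. Since `κ E = 0`, `‖l
    -- E‖` is at most `C * ∫ ‖φ‖ dκ` plus the approximation error for `l`, hence at most `C + 1`
    -- times the total error.
    obtain ⟨φ, r, -, -, -, hφ⟩ := exists_cc_approx (l.variation + κ) hE
      (ε := ε / (C + 1)) (by positivity)
    have hEm := hE.measurableSet
    have hi : ∀ (m : Measure S) [IsFiniteMeasure m],
        Integrable (fun x => φ x - E.indicator (fun _ => (1 : ℂ)) x) m := fun m _ =>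
      (integrable_cc m φ).sub ((integrable_const 1).indicator hEm)
    rw [integral_add_measure (hi _).norm (hi _).norm] at hφ
    have hE0 : ∀ᵐ x ∂κ, x ∉ E := measure_eq_zero_iff_ae_notMem.1 h0
    have e1 : ∫ x, ‖φ x - E.indicator (fun _ => (1 : ℂ)) x‖ ∂κ = ∫ x, ‖φ x‖ ∂κ :=
      integral_congr_ae (by filter_upwards [hE0] with x hx; simp [hx])
    have e2 : l E = cint l φ - cint l (fun x => φ x - E.indicator (fun _ => (1 : ℂ)) x) := by
      rw [cint_sub (integrable_cc _ φ) ((integrable_const 1).indicator hEm), cint_indicator l hEm]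
      ring
    have h3 := norm_cint_le l (fun x => φ x - E.indicator (fun _ => (1 : ℂ)) x)
    have h4 := hC φ
    rw [e1] at hφ
    have h5 : 0 ≤ ∫ x, ‖φ x‖ ∂κ := integral_nonneg fun _ => norm_nonneg _
    have h6 : 0 ≤ ∫ x, ‖φ x - E.indicator (fun _ => (1 : ℂ)) x‖ ∂l.variation :=
      integral_nonneg fun _ => norm_nonneg _
    rw [le_div_iff₀ (by positivity)] at hφ
    rw [e2, zero_add]
    refine (norm_sub_le _ _).trans ?_
    nlinarith
  -- Inner regularity of `l.variation` extends the compact case to Borel sets.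
  refine variation_absolutelyContinuous fun A hA h0 => ?_
  rw [← norm_le_zero_iff]
  refine le_of_forall_pos_le_add fun ε hε => ?_
  obtain ⟨K, hKA, hK, hlt⟩ := hA.exists_isCompact_sdiff_lt (measure_ne_top l.variation A)
      (ε := ENNReal.ofReal ε) (by simpa using hε)
  have e : l A = l K + l (A \ K) := by
    rw [← VectorMeasure.of_union disjoint_sdiff_right hK.measurableSet
      (hA.diff hK.measurableSet), union_sdiff_cancel hKA]
  rw [e, hcomp K hK (measure_mono_null hKA h0), zero_add, zero_add]
  have h1 := VectorMeasure.norm_measure_le_variation (μ := l) (E := A \ K)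
  exact h1.trans (ENNReal.toReal_le_of_le_ofReal hε.le hlt.le)

/-- An estimate for the difference of two iterated integrals. -/
theorem norm_integral_integral_sub_le (m₁ m₂ : Measure S) [IsFiniteMeasure m₁] [IsFiniteMeasure m₂]
    [m₁.Regular] [m₂.Regular] {h h' : S → S → ℂ} (hc : Continuous fun p : S × S => h p.1 p.2)
    (hc' : Continuous fun p : S × S => h' p.1 p.2)
    (C : ℝ) (hC : ∀ x y, ‖h x y‖ ≤ C) (hC' : ∀ x y, ‖h' x y‖ ≤ C) {u v : S → ℝ}
    (hu : Integrable u m₁) (hv : Integrable v m₂) (huv : ∀ x y, ‖h x y - h' x y‖ ≤ u x + v y) :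
    ‖(∫ y, ∫ x, h x y ∂m₁ ∂m₂) - ∫ y, ∫ x, h' x y ∂m₁ ∂m₂‖ ≤
      m₂.real univ * ∫ x, u x ∂m₁ + m₁.real univ * ∫ y, v y ∂m₂ := by
  have key : ∀ g : S → S → ℂ, (Continuous fun p : S × S => g p.1 p.2) → (∀ x y, ‖g x y‖ ≤ C) →
      (∀ y, Integrable (fun x => g x y) m₁) ∧ Integrable (fun y => ∫ x, g x y ∂m₁) m₂ := by
    intro g hg hgC
    have hx : ∀ y, Continuous fun x => g x y := fun y => hg.comp (Continuous.prodMk_left y)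
    refine ⟨fun y => integrable_of_continuous _ (hx y) C fun x => hgC x y, ?_⟩
    have h1 := continuous_cint (ofMeasure_mem m₁) hg C hgC
    have h2 := fun y => norm_cint_le_of_bound (ofMeasure m₁) (hx y) C fun x => hgC x y
    simp only [cint_ofMeasure] at h1 h2
    exact integrable_of_continuous _ h1 _ h2
  obtain ⟨i1, i2⟩ := key h hc hC
  obtain ⟨j1, j2⟩ := key h' hc' hC'
  rw [← integral_sub i2 j2]
  refine (norm_integral_le_integral_norm _).trans ?_
  have hb : ∀ y, ‖(∫ x, h x y ∂m₁) - ∫ x, h' x y ∂m₁‖ ≤ ∫ x, u x ∂m₁ + m₁.real univ * v y := by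
    intro y
    rw [← integral_sub (i1 y) (j1 y)]
    refine (norm_integral_le_integral_norm _).trans ?_
    refine (integral_mono ((i1 y).sub (j1 y)).norm (hu.add (integrable_const (v y)))
      fun x => huv x y).trans (le_of_eq ?_)
    simp only [Pi.add_apply]
    rw [integral_add hu (integrable_const _), integral_const, smul_eq_mul]
  refine (integral_mono (i2.sub j2).norm ((integrable_const _).add (hv.const_mul _)) hb).trans
    (le_of_eq ?_)
  simp only [Pi.add_apply]
  rw [integral_add (integrable_const _) (hv.const_mul _), integral_const, smul_eq_mul,
    integral_const_mul]

/-- These cutoffs reduce Fubini's theorem to integrands of compact support. Without second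
countability, a continuous function on `S × S` need not be measurable for the product σ-algebra. -/
theorem exists_cutoff (m : Measure S) [IsFiniteMeasure m] [m.Regular] {ε : ℝ} (hε : 0 < ε) :
    ∃ r : C(S, ℝ), HasCompactSupport r ∧ (∀ x, r x ∈ Icc (0 : ℝ) 1) ∧
      ∫ x, (1 - r x) ∂m ≤ ε := by
  obtain ⟨K, -, hK, hlt⟩ := MeasurableSet.univ.exists_isCompact_sdiff_lt (measure_ne_top m univ)
    (ε := ENNReal.ofReal ε) (by simpa using hε)
  obtain ⟨r, hr1, -, hrc, hr01⟩ := exists_continuous_one_zero_of_isCompact hK isClosed_empty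
    (disjoint_empty K)
  refine ⟨r, hrc, hr01, ?_⟩
  have hKm := hK.measurableSet.compl
  have hb : ∀ x, 1 - r x ≤ Kᶜ.indicator (fun _ => (1 : ℝ)) x := by
    intro x
    by_cases hx : x ∈ K
    · simp [hx, hr1 hx]
    · simp [hx, (hr01 x).1]
  have hi : Integrable (fun x => 1 - r x) m :=
    Integrable.of_bound (by fun_prop) 1 (Eventually.of_forall fun x => by
      have := hr01 x
      rw [Real.norm_of_nonneg (by linarith [this.2])]
      linarith [this.1])
  refine (integral_mono hi ((integrable_const (1 : ℝ)).indicator hKm) hb).trans ?_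
  rw [integral_indicator_const _ hKm, smul_eq_mul, mul_one, compl_eq_univ_sdiff]
  exact ENNReal.toReal_le_of_le_ofReal hε.le hlt.le

/-- Fubini's theorem for bounded continuous functions and Radon measures. -/
theorem integral_swap_of_bounded (m₁ m₂ : Measure S) [IsFiniteMeasure m₁] [IsFiniteMeasure m₂]
    [m₁.Regular] [m₂.Regular] {h : S → S → ℂ} (hc : Continuous fun p : S × S => h p.1 p.2)
    (C : ℝ) (hC : ∀ x y, ‖h x y‖ ≤ C) :
    ∫ y, ∫ x, h x y ∂m₁ ∂m₂ = ∫ x, ∫ y, h x y ∂m₂ ∂m₁ := by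
  rw [← sub_eq_zero, ← norm_le_zero_iff]
  refine le_of_forall_pos_le_add fun ε hε => ?_
  set M := m₁.real univ + m₂.real univ + 1 with hM
  have hM1 : 0 ≤ m₁.real univ := measureReal_nonneg
  have hM2 : 0 ≤ m₂.real univ := measureReal_nonneg
  have hM0 : 0 < M := by positivity
  have hC0 : 0 < |C| + 1 := by positivity
  -- Truncation costs at most `M * (|C| + 1) * δ = ε / 2` in each of the two orders of integration.
  set δ := ε / (2 * M * (|C| + 1)) with hδ
  have hδ0 : 0 < δ := by positivity
  obtain ⟨r₁, hr₁, h₁, d₁⟩ := exists_cutoff m₁ hδ0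
  obtain ⟨r₂, hr₂, h₂, d₂⟩ := exists_cutoff m₂ hδ0
  let h' : S → S → ℂ := fun x y => (r₁ x * r₂ y : ℝ) * h x y
  have hc' : Continuous fun p : S × S => h' p.1 p.2 := by
    have : Continuous fun p : S × S => r₁ p.1 * r₂ p.2 := by fun_prop
    exact (Complex.continuous_ofReal.comp this).mul hc
  have hr : ∀ x y, 0 ≤ r₁ x * r₂ y ∧ r₁ x * r₂ y ≤ 1 := fun x y =>
    ⟨mul_nonneg (h₁ x).1 (h₂ y).1, mul_le_one₀ (h₁ x).2 (h₂ y).1 (h₂ y).2⟩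
  have hC' : ∀ x y, ‖h' x y‖ ≤ C := fun x y => by
    rw [norm_mul, Complex.norm_real, Real.norm_of_nonneg (hr x y).1]
    exact (mul_le_of_le_one_left (norm_nonneg _) (hr x y).2).trans (hC x y)
  have hsupp : HasCompactSupport (Function.uncurry h') := by
    refine HasCompactSupport.intro (hr₁.isCompact.prod hr₂.isCompact) fun p hp => ?_
    rw [mem_prod, not_and_or] at hp
    rcases hp with hp | hp
    · simp [Function.uncurry, h', image_eq_zero_of_notMem_tsupport hp]
    · simp [Function.uncurry, h', image_eq_zero_of_notMem_tsupport hp]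
  have hswap : ∫ y, ∫ x, h' x y ∂m₁ ∂m₂ = ∫ x, ∫ y, h' x y ∂m₂ ∂m₁ :=
    (integral_integral_swap_of_hasCompactSupport hc' hsupp).symm
  -- From `1 - s * t ≤ (1 - s) + (1 - t)` on the unit square. The bound separates the variables, so
  -- that only single integrals are needed.
  have hdiff : ∀ x y, ‖h x y - h' x y‖ ≤ (|C| + 1) * (1 - r₁ x) + (|C| + 1) * (1 - r₂ y) := by
    intro x y
    have e : h x y - h' x y = ((1 - r₁ x * r₂ y : ℝ) : ℂ) * h x y := by
      simp only [h']; push_cast; ring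
    rw [e, norm_mul, Complex.norm_real, Real.norm_of_nonneg (by linarith [(hr x y).2]), ← mul_add,
      mul_comm]
    refine mul_le_mul ((hC x y).trans (by linarith [le_abs_self C])) ?_
      (by linarith [(hr x y).2]) hC0.le
    nlinarith [(h₁ x).1, (h₁ x).2, (h₂ y).1, (h₂ y).2]
  have hint : ∀ (m : Measure S) [IsFiniteMeasure m] (r : C(S, ℝ)), (∀ x, r x ∈ Icc (0 : ℝ) 1) →
      Integrable (fun x => (|C| + 1) * (1 - r x)) m := fun m _ r h01 =>
    (Integrable.of_bound (by fun_prop) 1 (Eventually.of_forall fun x => by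
      have := h01 x
      rw [Real.norm_of_nonneg (by linarith [this.2])]
      linarith [this.1])).const_mul _
  have b1 := norm_integral_integral_sub_le m₁ m₂ hc hc' C hC hC' (hint m₁ r₁ h₁) (hint m₂ r₂ h₂)
    hdiff
  have b2 := norm_integral_integral_sub_le m₂ m₁ (h := fun y x => h x y) (h' := fun y x => h' x y)
    (hc.comp continuous_swap) (hc'.comp continuous_swap) C (fun y x => hC x y)
    (fun y x => hC' x y) (hint m₂ r₂ h₂) (hint m₁ r₁ h₁)
    (fun y x => (hdiff x y).trans_eq (add_comm _ _))
  rw [integral_const_mul, integral_const_mul] at b1 b2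
  have q1 : (|C| + 1) * ∫ x, (1 - r₁ x) ∂m₁ ≤ (|C| + 1) * δ := by gcongr
  have q2 : (|C| + 1) * ∫ x, (1 - r₂ x) ∂m₂ ≤ (|C| + 1) * δ := by gcongr
  have q3 : M * ((|C| + 1) * δ) = ε / 2 := by
    rw [hδ]
    field_simp
  have q4 : 0 ≤ (|C| + 1) * δ := by positivity
  rw [hswap] at b1
  have b3 := norm_sub_le_norm_sub_add_norm_sub (∫ y, ∫ x, h x y ∂m₁ ∂m₂)
    (∫ x, ∫ y, h' x y ∂m₂ ∂m₁) (∫ x, ∫ y, h x y ∂m₂ ∂m₁)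
  rw [norm_sub_rev (∫ x, ∫ y, h' x y ∂m₂ ∂m₁)] at b3
  have s1 := mul_le_mul_of_nonneg_left q1 hM1
  have s2 := mul_le_mul_of_nonneg_left q1 hM2
  have s3 := mul_le_mul_of_nonneg_left q2 hM1
  have s4 := mul_le_mul_of_nonneg_left q2 hM2
  rw [hM] at q3
  nlinarith

/-- Both sides are linear in `a` and in `b`, so `radon_induction`, applied twice, leaves the case of
two positive measures. -/
theorem cint_swap {a b : ComplexMeasure S} (ha : a ∈ radonSubmodule S) (hb : b ∈ radonSubmodule S)
    {h : S → S → ℂ} (hc : Continuous fun p : S × S => h p.1 p.2)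
    (C : ℝ) (hC : ∀ x y, ‖h x y‖ ≤ C) :
    cint b (fun y => cint a fun x => h x y) = cint a (fun x => cint b fun y => h x y) := by
  have hcx : ∀ y, Continuous fun x => h x y := fun y => hc.comp (Continuous.prodMk_left y)
  have hcy : ∀ x, Continuous fun y => h x y := fun x => hc.comp (Continuous.prodMk_right x)
  have hc' : Continuous fun p : S × S => h p.2 p.1 := hc.comp continuous_swap
  have ix : ∀ (ν : ComplexMeasure S) y, Integrable (fun x => h x y) ν.variation := fun ν y =>
    integrable_of_continuous _ (hcx y) C fun x => hC x y
  have iy : ∀ (ν : ComplexMeasure S) x, Integrable (fun y => h x y) ν.variation := fun ν x =>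
    integrable_of_continuous _ (hcy x) C fun y => hC x y
  have ixy : ∀ {ν : ComplexMeasure S} (ν' : ComplexMeasure S), ν ∈ radonSubmodule S →
      Integrable (fun y => cint ν fun x => h x y) ν'.variation := fun {ν} ν' hν =>
    integrable_of_continuous _ (continuous_cint hν hc C hC) _ fun y =>
      norm_cint_le_of_bound ν (hcx y) C fun x => hC x y
  have iyx : ∀ {ν : ComplexMeasure S} (ν' : ComplexMeasure S), ν ∈ radonSubmodule S →
      Integrable (fun x => cint ν fun y => h x y) ν'.variation := fun {ν} ν' hν =>
    integrable_of_continuous _ (continuous_cint (h := fun y x => h x y) hν hc' C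
      fun y x => hC x y) _ fun x => norm_cint_le_of_bound ν (hcy x) C fun y => hC x y
  refine radon_induction (P := fun b => cint b (fun y => cint a fun x => h x y) =
    cint a (fun x => cint b fun y => h x y)) ?_ ?_ ?_ hb
  · intro m _ _
    refine radon_induction (P := fun a => cint (ofMeasure m) (fun y => cint a fun x => h x y) =
      cint a (fun x => cint (ofMeasure m) fun y => h x y)) ?_ ?_ ?_ ha
    · intro m' _ _
      simp only [cint_ofMeasure]
      exact integral_swap_of_bounded m' m hc C hC
    · intro a ha a' ha' e e'
      rw [cint_add_measure (iyx _ (ofMeasure_mem m)) (iyx _ (ofMeasure_mem m)), ← e, ← e',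
        ← cint_add (ixy _ ha) (ixy _ ha')]
      exact cint_congr fun y => cint_add_measure (ix _ y) (ix _ y)
    · intro c a ha e
      rw [cint_smul_measure _ (iyx _ (ofMeasure_mem m)), ← e, ← cint_const_mul]
      exact cint_congr fun y => cint_smul_measure _ (ix _ y)
  · intro b hb b' hb' e e'
    rw [cint_add_measure (ixy _ ha) (ixy _ ha), e, e', ← cint_add (iyx _ hb) (iyx _ hb')]
    exact cint_congr fun x => (cint_add_measure (iy _ x) (iy _ x)).symm
  · intro c b hb e
    rw [cint_smul_measure _ (ixy _ ha), e, ← cint_const_mul]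
    exact cint_congr fun x => (cint_smul_measure _ (iy _ x)).symm

end Regular

/-! ### Countable additivity from domination by a measure. -/

section Additive

variable {S : Type*} [MeasurableSpace S]

/-- A finitely additive set function dominated by a finite measure is a complex measure. -/
theorem exists_complexMeasure_of_dominated (m : Measure S) [IsFiniteMeasure m] {G : Set S → ℂ}
    (hadd : ∀ A B, MeasurableSet A → MeasurableSet B → Disjoint A B → G (A ∪ B) = G A + G B)
    {C : ℝ} (hC : ∀ A, MeasurableSet A → ‖G A‖ ≤ C * m.real A) :
    ∃ τ : ComplexMeasure S, ∀ A, MeasurableSet A → τ A = G A := by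
  classical
  have h0 : G ∅ = 0 := by
    have := hC ∅ MeasurableSet.empty
    simpa using this
  have hfin : ∀ (f : ℕ → Set S), (∀ i, MeasurableSet (f i)) → Pairwise (Function.onFun Disjoint f) →
      ∀ s : Finset ℕ, G (⋃ i ∈ s, f i) = ∑ i ∈ s, G (f i) := by
    intro f hf hd s
    induction s using Finset.induction_on with
    | empty => simp [h0]
    | insert a s ha ih =>
      rw [Finset.set_biUnion_insert, hadd _ _ (hf a) (s.measurableSet_biUnion fun i _ => hf i),
        ih, Finset.sum_insert ha]
      rw [disjoint_iUnion₂_right]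
      exact fun i hi => hd fun h => ha (h ▸ hi)
  refine ⟨{
    measureOf' := fun A => if MeasurableSet A then G A else 0
    empty' := by simp [h0]
    not_measurable' := fun A hA => by simp [hA]
    m_iUnion' := ?_ }, fun A hA => if_pos hA⟩
  intro f hf hd
  simp only [hf, MeasurableSet.iUnion hf, if_true]
  rw [HasSum, SummationFilter.unconditional_filter, tendsto_iff_norm_sub_tendsto_zero]
  -- By finite additivity the error of a partial sum is `G` of the union of the remaining sets,
  -- hence at most `C` times the `m`-measure of that remainder.
  have hlim : Tendsto (fun s : Finset ℕ => C * (m.real (⋃ i, f i) - ∑ i ∈ s, m.real (f i))) atTop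
      (𝓝 0) := by
    have hs : HasSum (fun i => m.real (f i)) (m.real (⋃ i, f i)) := by
      have := ENNReal.hasSum_toReal (f := fun i => m (f i)) (by
        rw [← measure_iUnion hd hf]; exact measure_ne_top _ _)
      rwa [← ENNReal.tsum_toReal_eq (fun i => measure_ne_top _ _), ← measure_iUnion hd hf] at this
    have := (tendsto_const_nhds (x := m.real (⋃ i, f i))).sub hs
    rw [sub_self] at this
    simpa using this.const_mul C
  refine squeeze_zero (fun _ => norm_nonneg _) (fun s => ?_) hlim
  have hsm : MeasurableSet (⋃ i ∈ s, f i) := s.measurableSet_biUnion fun i _ => hf i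
  have hsub : (⋃ i ∈ s, f i) ⊆ ⋃ i, f i := iUnion₂_subset fun i _ => subset_iUnion f i
  have e : G (⋃ i, f i) = G (⋃ i ∈ s, f i) + G ((⋃ i, f i) \ ⋃ i ∈ s, f i) := by
    rw [← hadd _ _ hsm ((MeasurableSet.iUnion hf).diff hsm) disjoint_sdiff_right,
      union_sdiff_cancel hsub]
  rw [← hfin f hf hd, norm_sub_rev, e, add_sub_cancel_left]
  refine (hC _ ((MeasurableSet.iUnion hf).diff hsm)).trans (le_of_eq ?_)
  rw [measureReal_sdiff hsub hsm, measureReal_biUnion_finset (fun i _ j _ h => hd h)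
    fun i _ => hf i]

end Additive

/-! ### The dual of `M(S)` on the measures absolutely continuous with respect to `m`. -/

section Dual

variable {S : Type*} [TopologicalSpace S] [T2Space S] [MeasurableSpace S] [BorelSpace S]

namespace RadonMeasure

/-- The restriction of a finite Radon measure to a set. -/
noncomputable def restrict (m : Measure S) [IsFiniteMeasure m] [m.Regular] (A : Set S) :
    RadonMeasure S :=
  ofRegular (m.restrict A) (regular_of_le Measure.restrict_le_self)

theorem restrict_toComplex (m : Measure S) [IsFiniteMeasure m] [m.Regular] (A : Set S) :
    (restrict m A).toComplex = ofMeasure (m.restrict A) := rfl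

theorem restrict_toComplex_eq_withDensity (m : Measure S) [IsFiniteMeasure m] [m.Regular]
    {A : Set S} (hA : MeasurableSet A) :
    (restrict m A).toComplex = m.withDensityᵥ (A.indicator fun _ => (1 : ℂ)) := by
  ext B hB
  rw [restrict_toComplex, ofMeasure_apply _ hB,
    withDensityᵥ_apply ((integrable_const 1).indicator hA) hB, integral_indicator hA,
    Measure.restrict_restrict hA]
  simp [measureReal_restrict_apply hB, inter_comm]

theorem norm_restrict (m : Measure S) [IsFiniteMeasure m] [m.Regular] (A : Set S) :
    ‖restrict m A‖ = m.real A := by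
  rw [norm_def, tv, restrict_toComplex, variation_ofMeasure]
  simp [Measure.real]

theorem restrict_union (m : Measure S) [IsFiniteMeasure m] [m.Regular] {A B : Set S}
    (hB : MeasurableSet B) (hd : Disjoint A B) :
    restrict m (A ∪ B) = restrict m A + restrict m B := by
  apply toComplex_injective
  rw [toComplex_add]
  ext E hE
  rw [_root_.add_apply]
  simp only [restrict_toComplex, ofMeasure_apply _ hE]
  rw [Measure.restrict_union hd hB, measureReal_add_apply]
  push_cast
  rfl

/-- Integration of a bounded measurable function as a functional on `M(S)`. -/
noncomputable def cintCLM (g : S → ℂ) (hg : Measurable g) (C : ℝ) (hC : ∀ x, ‖g x‖ ≤ C) :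
    RadonMeasure S →L[ℂ] ℂ :=
  have hi : ∀ l : RadonMeasure S, Integrable g l.toComplex.variation := fun _ =>
    Integrable.of_bound hg.aestronglyMeasurable C (Eventually.of_forall hC)
  LinearMap.mkContinuous
    { toFun := fun l => cint l.toComplex g
      map_add' := fun l l' => cint_add_measure (hi l) (hi l')
      map_smul' := fun c l => cint_smul_measure c (hi l) } C fun l => by
    refine (norm_cint_le _ _).trans ?_
    refine (integral_mono (hi l).norm (integrable_const C) hC).trans (le_of_eq ?_)
    simp [norm_def, tv, mul_comm]

theorem cintCLM_apply (g : S → ℂ) (hg : Measurable g) (C : ℝ) (hC : ∀ x, ‖g x‖ ≤ C)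
    (l : RadonMeasure S) : cintCLM g hg C hC l = cint l.toComplex g := rfl

/-- A functional on `M(S)` that vanishes on the restrictions of `m` vanishes on all measures that
are absolutely continuous with respect to `m`. -/
theorem eq_zero_of_restrict (F : RadonMeasure S →L[ℂ] ℂ) (m : Measure S) [IsFiniteMeasure m]
    [m.Regular] (hF : ∀ A, MeasurableSet A → F (restrict m A) = 0) {l : RadonMeasure S}
    (hl : l.tv ≪ m) : F l = 0 := by
  obtain ⟨h, hh, e⟩ := exists_density hl
  -- It remains to pass from indicators to all densities in `L¹(m)`: linearity gives simple
  -- functions, and the limit step uses that `h ↦ h m` is isometric from `L¹(m)` to `M(S)`.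
  have key : ∀ ⦃h : S → ℂ⦄, Integrable h m →
      ∃ l : RadonMeasure S, l.toComplex = m.withDensityᵥ h ∧ F l = 0 := by
    refine fun h hh => Integrable.induction
      (P := fun h => ∃ l : RadonMeasure S, l.toComplex = m.withDensityᵥ h ∧ F l = 0)
      ?_ ?_ ?_ ?_ hh
    · intro c A hA _
      refine ⟨c • restrict m A, ?_, by rw [map_smul, hF A hA, smul_zero]⟩
      rw [toComplex_smul, restrict_toComplex_eq_withDensity m hA, ← withDensityᵥ_smul]
      congr 1
      ext x
      by_cases hx : x ∈ A <;> simp [hx]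
    · rintro f g - hf hg ⟨l, e, h0⟩ ⟨l', e', h0'⟩
      exact ⟨l + l', by rw [toComplex_add, e, e', withDensityᵥ_add hf hg],
        by rw [map_add, h0, h0', add_zero]⟩
    · refine isClosed_of_closure_subset fun f hf => ?_
      obtain ⟨l, e⟩ := exists_radonMeasure_withDensity (L1.integrable_coeFn f)
      refine ⟨l, e, ?_⟩
      rw [← norm_le_zero_iff]
      refine le_of_forall_pos_le_add fun ε hε => ?_
      obtain ⟨f', ⟨l', e', h0⟩, hlt⟩ := Metric.mem_closure_iff.1 hf (ε / (‖F‖ + 1))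
        (by positivity)
      have hd : (l - l').toComplex = m.withDensityᵥ (f - f' : S → ℂ) := by
        rw [withDensityᵥ_sub (L1.integrable_coeFn f) (L1.integrable_coeFn f'), ← e, ← e']
        rfl
      have hn : ‖l - l'‖ = dist f f' := by
        rw [norm_eq_of_withDensity ((L1.integrable_coeFn f).sub (L1.integrable_coeFn f')) hd,
          dist_eq_norm, L1.norm_eq_integral_norm]
        refine integral_congr_ae ?_
        filter_upwards [Lp.coeFn_sub f f'] with x hx
        rw [hx]
      have h1 : F l = F (l - l') := by rw [map_sub, h0, sub_zero]
      rw [h1, zero_add]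
      refine (F.le_opNorm _).trans ?_
      rw [hn]
      rw [lt_div_iff₀ (by positivity)] at hlt
      nlinarith [norm_nonneg F, dist_nonneg (x := f) (y := f')]
    · rintro f g hfg hf ⟨l, e, h0⟩
      exact ⟨l, e.trans (WithDensityᵥEq.congr_ae hfg), h0⟩
  obtain ⟨l', e', h0⟩ := key hh
  rwa [toComplex_injective (e.trans e'.symm)]

/-- Truncation of a complex number. -/
noncomputable def clamp (C : ℝ) (z : ℂ) : ℂ := ⟨max (-C) (min C z.re), max (-C) (min C z.im)⟩

theorem continuous_clamp (C : ℝ) : Continuous (clamp C) := by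
  have : clamp C = fun z : ℂ => ((max (-C) (min C z.re) : ℝ) : ℂ) +
      ((max (-C) (min C z.im) : ℝ) : ℂ) * Complex.I := by
    ext z
    exact (Complex.mk_eq_add_mul_I _ _)
  rw [this]
  fun_prop

theorem clamp_of_norm_le {C : ℝ} {z : ℂ} (hz : ‖z‖ ≤ C) : clamp C z = z := by
  have h1 := abs_le.1 ((Complex.abs_re_le_norm z).trans hz)
  have h2 := abs_le.1 ((Complex.abs_im_le_norm z).trans hz)
  apply Complex.ext
  · change max (-C) (min C z.re) = z.re
    rw [min_eq_right h1.2, max_eq_right h1.1]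
  · change max (-C) (min C z.im) = z.im
    rw [min_eq_right h2.2, max_eq_right h2.1]

/-- The two coordinates are truncated separately, so values lie in a square, not in the disc of
radius `C`; hence the factor 2. -/
theorem norm_clamp_le {C : ℝ} (hC : 0 ≤ C) (z : ℂ) : ‖clamp C z‖ ≤ 2 * C := by
  refine (Complex.norm_le_abs_re_add_abs_im _).trans ?_
  have h : ∀ t : ℝ, |max (-C) (min C t)| ≤ C := fun t =>
    abs_le.2 ⟨le_max_left _ _, max_le (by linarith) (min_le_left _ _)⟩
  have h1 := h z.re
  have h2 := h z.im
  change |max (-C) (min C z.re)| + |max (-C) (min C z.im)| ≤ 2 * C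
  linarith

/-- On the measures that are absolutely continuous with respect to `m`, a functional on `M(S)` is
given by a bounded density. -/
theorem exists_dual_density (F : RadonMeasure S →L[ℂ] ℂ) (m : Measure S) [IsFiniteMeasure m]
    [m.Regular] : ∃ g : S → ℂ, Measurable g ∧ (∀ᵐ x ∂m, ‖g x‖ ≤ ‖F‖) ∧
      (∀ x, ‖g x‖ ≤ 2 * ‖F‖) ∧ ∀ l : RadonMeasure S, l.tv ≪ m → F l = cint l.toComplex g := by
  -- The set function `A ↦ F (m|_A)` is additive and bounded by `‖F‖ * m A`, because `m|_A` has norm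
  -- `m A`. Its density with respect to `m` is the function sought.
  obtain ⟨τ, hτ⟩ := exists_complexMeasure_of_dominated m (G := fun A => F (restrict m A))
    (fun A B _ hB hd => by rw [restrict_union m hB hd, map_add]) (C := ‖F‖) fun A _ => by
      rw [← norm_restrict]
      exact F.le_opNorm _
  have hvar : τ.variation ≤ ENNReal.ofReal ‖F‖ • m := by
    refine VectorMeasure.variation_le_of_forall_enorm_le fun A hA => ?_
    rw [hτ A hA, ← ofReal_norm, Measure.smul_apply, smul_eq_mul, ← ofReal_measureReal,
      ← ENNReal.ofReal_mul (norm_nonneg _), ← norm_restrict]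
    exact ENNReal.ofReal_le_ofReal (F.le_opNorm _)
  obtain ⟨g₀, hg₀, e⟩ := exists_density (ν := τ) (m := m)
    (hvar.absolutelyContinuous.trans (Measure.smul_absolutelyContinuous))
  have hb : ∀ᵐ x ∂m, ‖g₀ x‖ ≤ ‖F‖ := by
    have : (fun x => ‖g₀ x‖ₑ) ≤ᵐ[m] fun _ => ENNReal.ofReal ‖F‖ := by
      refine ae_le_of_forall_setLIntegral_le_of_sigmaFinite₀ hg₀.1.enorm fun A hA _ => ?_
      have h1 := hvar A
      rw [e, Measure.variation_withDensityᵥ hg₀, withDensity_apply _ hA] at h1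
      simpa using h1
    filter_upwards [this] with x hx
    rw [← ofReal_norm] at hx
    exact (ENNReal.ofReal_le_ofReal_iff (norm_nonneg _)).1 hx
  have hgm := hg₀.1.measurable_mk
  -- Clamping a measurable representative makes the bound hold everywhere, and changes nothing at
  -- the almost all points where `‖g₀ x‖ ≤ ‖F‖`.
  set g : S → ℂ := fun x => clamp ‖F‖ (hg₀.1.mk g₀ x) with hg
  have hgg : g =ᵐ[m] g₀ := by
    filter_upwards [hb, hg₀.1.ae_eq_mk] with x hx hx'
    simp only [hg]
    rw [← hx', clamp_of_norm_le hx]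
  have hgmeas : Measurable g := (continuous_clamp _).measurable.comp hgm
  have hgb : ∀ x, ‖g x‖ ≤ 2 * ‖F‖ := fun x => norm_clamp_le (norm_nonneg _) _
  refine ⟨g, hgmeas, ?_, hgb, fun l hl => ?_⟩
  · filter_upwards [hb, hgg] with x hx hx'
    rwa [hx']
  have := eq_zero_of_restrict (F - cintCLM g hgmeas _ hgb) m (fun A hA => ?_) hl
  · rwa [_root_.sub_apply, cintCLM_apply, sub_eq_zero] at this
  · rw [_root_.sub_apply, cintCLM_apply, restrict_toComplex, cint_ofMeasure,
      ← hτ A hA, e, withDensityᵥ_apply hg₀ hA, sub_eq_zero]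
    exact (integral_congr_ae (ae_restrict_of_ae hgg)).symm

variable [LocallyCompactSpace S]

/-- Compactly supported continuous functions are dense in `L¹` of a finite Radon measure. -/
theorem exists_cc_eLpNorm_sub_le (m : Measure S) [IsFiniteMeasure m] [m.Regular] {f : S → ℂ}
    (hf : Integrable f m) {ε : ℝ≥0∞} (hε : ε ≠ 0) :
    ∃ g : S → ℂ, eLpNorm (f - g) 1 m ≤ ε ∧ Continuous g ∧ HasCompactSupport g := by
  have h1 : ∀ f g : S → ℂ, (Continuous f ∧ HasCompactSupport f) →
      (Continuous g ∧ HasCompactSupport g) → Continuous (f + g) ∧ HasCompactSupport (f + g) :=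
    fun f g hf hg => ⟨hf.1.add hg.1, hf.2.add hg.2⟩
  have h2 : ∀ f : S → ℂ, (Continuous f ∧ HasCompactSupport f) → AEStronglyMeasurable f m :=
    fun f hf => hf.1.aestronglyMeasurable
  refine MemLp.induction_dense ENNReal.one_ne_top
    (fun g : S → ℂ => Continuous g ∧ HasCompactSupport g) ?_ h1 h2
    (memLp_one_iff_integrable.2 hf) hε
  intro c A hA _ ε hε
  -- The minimum with 1 covers `ε = ∞`.
  obtain ⟨δ, hδ, hδε⟩ : ∃ δ : ℝ, 0 < δ ∧ ENNReal.ofReal δ ≤ ε := by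
    refine ⟨(min ε 1).toReal, ENNReal.toReal_pos (by simp [hε]) (by simp), ?_⟩
    rw [ENNReal.ofReal_toReal (by simp)]
    exact min_le_left _ _
  -- Two errors of size `η`, from `A` to `K` and from the indicator of `K` to `φ`, each multiplied
  -- by `‖c‖`.
  set η := δ / (2 * (‖c‖ + 1)) with hη
  have hη0 : 0 < η := by positivity
  obtain ⟨K, hKA, hK, hlt⟩ := hA.exists_isCompact_sdiff_lt (measure_ne_top m A)
    (ε := ENNReal.ofReal η) (by simpa using hη0)
  obtain ⟨φ, r, -, -, -, hφ⟩ := exists_cc_approx m hK hη0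
  refine ⟨fun x => φ x * c, ?_, φ.continuous.mul continuous_const,
    HasCompactSupport.mul_right (f := φ) (f' := fun _ => c) φ.hasCompactSupport⟩
  have hd : MeasurableSet (A \ K) := hA.diff hK.measurableSet
  have i1 : Integrable (fun x => φ x - K.indicator (fun _ => (1 : ℂ)) x) m :=
    (integrable_cc m φ).sub ((integrable_const 1).indicator hK.measurableSet)
  have i2 : Integrable ((A \ K).indicator fun _ => (1 : ℝ)) m := (integrable_const 1).indicator hd
  have i3 : Integrable ((fun x => φ x * c) - A.indicator fun _ => c) m :=
    ((integrable_cc m φ).mul_const c).sub ((integrable_const c).indicator hA)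
  rw [eLpNorm_one_eq_lintegral_enorm, ← ofReal_integral_norm_eq_lintegral_enorm i3]
  refine (ENNReal.ofReal_le_ofReal ?_).trans hδε
  have hb : ∀ x, ‖((fun x => φ x * c) - A.indicator fun _ => c) x‖ ≤
      ‖c‖ * (‖φ x - K.indicator (fun _ => (1 : ℂ)) x‖ +
        (A \ K).indicator (fun _ => (1 : ℝ)) x) := by
    intro x
    by_cases hxK : x ∈ K
    · have hxA := hKA hxK
      have e : φ x * c - c = c * (φ x - 1) := by ring
      simp [hxK, hxA, e]
    · by_cases hxA : x ∈ A
      · simp only [Pi.sub_apply, hxK, hxA, not_false_eq_true, indicator_of_notMem,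
          indicator_of_mem, sub_zero, Set.mem_sdiff, and_self]
        refine (norm_sub_le _ _).trans (le_of_eq ?_)
        rw [norm_mul]
        ring
      · simp [hxK, hxA, mul_comm]
  refine (integral_mono i3.norm ((i1.norm.add i2).const_mul _) hb).trans ?_
  simp only [Pi.add_apply]
  rw [integral_const_mul, integral_add i1.norm i2, integral_indicator_const _ hd, smul_eq_mul,
    mul_one]
  have h1 : m.real (A \ K) ≤ η := ENNReal.toReal_le_of_le_ofReal hη0.le hlt.le
  have h2 : (‖c‖ + 1) * (2 * η) = δ := by
    rw [hη]
    field_simp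
  nlinarith [norm_nonneg c]

/-- On the measures that are absolutely continuous with respect to `m`, a functional on `M(S)` is
the limit of a bounded sequence of functions in `C_c(S)`. -/
theorem exists_dual_seq (F : RadonMeasure S →L[ℂ] ℂ) (m : Measure S) [IsFiniteMeasure m]
    [m.Regular] : ∃ (φ : ℕ → C_c(S, ℂ)) (C : ℝ), (∀ n x, ‖φ n x‖ ≤ C) ∧
      ∀ l : RadonMeasure S, l.tv ≪ m →
        Tendsto (fun n => cint l.toComplex (φ n)) atTop (𝓝 (F l)) := by
  obtain ⟨g, hgm, hb, hgb, hF⟩ := exists_dual_density F m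
  have hgi : Integrable g m :=
    Integrable.of_bound hgm.aestronglyMeasurable _ (Eventually.of_forall hgb)
  have hex : ∀ n : ℕ, ∃ u : S → ℂ, eLpNorm (g - u) 1 m ≤ ((n : ℝ≥0∞) + 1)⁻¹ ∧ Continuous u ∧
      HasCompactSupport u := fun n => exists_cc_eLpNorm_sub_le m hgi (by simp)
  choose u hu2 hu3 hu1 using hex
  -- Convergence in `L¹` gives convergence in measure, hence almost everywhere along a subsequence.
  have hmeas : TendstoInMeasure m u atTop g := by
    refine tendstoInMeasure_of_tendsto_eLpNorm one_ne_zero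
      (fun n => (hu3 n).aestronglyMeasurable) hgi.1 ?_
    refine tendsto_of_tendsto_of_tendsto_of_le_of_le tendsto_const_nhds ?_ (fun _ => zero_le)
      (fun n => (eLpNorm_sub_comm _ _ _ _).trans_le (hu2 n))
    have := ENNReal.tendsto_inv_nat_nhds_zero.comp (tendsto_add_atTop_nat 1)
    refine this.congr fun n => ?_
    simp
  obtain ⟨ns, -, hns⟩ := hmeas.exists_seq_tendsto_ae
  -- Clamping makes the sequence bounded; as it fixes 0 it preserves compact support, and as it
  -- fixes `g x` for almost every `x` it preserves the limit.
  have hz : clamp ‖F‖ 0 = 0 := clamp_of_norm_le (by simp)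
  refine ⟨fun n => ⟨⟨fun x => clamp ‖F‖ (u (ns n) x), (continuous_clamp _).comp (hu3 _)⟩,
    (hu1 _).comp_left hz⟩, 2 * ‖F‖, fun n x => norm_clamp_le (norm_nonneg _) _, fun l hl => ?_⟩
  rw [hF l hl]
  refine tendsto_cint (2 * ‖F‖) (fun n => ?_) (fun n x => norm_clamp_le (norm_nonneg _) _) ?_
  · exact ((continuous_clamp _).comp (hu3 _)).aestronglyMeasurable
  · refine hl.ae_le ?_
    filter_upwards [hns, hb] with x hx hxb
    have h1 := ((continuous_clamp ‖F‖).tendsto (g x)).comp hx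
    rwa [clamp_of_norm_le hxb] at h1

end RadonMeasure

end Dual

/-! ### Translates dominated by one measure; functionals of convolutions. -/

section Action

variable {S : Type*} [TopologicalSpace S] [T2Space S] [LocallyCompactSpace S] [MeasurableSpace S]
  [BorelSpace S]

/-- Otherwise the open null set where `q` is nonzero would be a neighbourhood of a point of the
support. -/
theorem eq_zero_of_mem_support {m : Measure S} [IsFiniteMeasure m] {q : S → ℝ} (hq : Continuous q)
    (h0 : ∀ x, 0 ≤ q x) (hi : Integrable q m) (h : ∫ x, q x ∂m = 0) {x : S}
    (hx : x ∈ m.support) : q x = 0 := by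
  rw [integral_eq_zero_iff_of_nonneg h0 hi] at h
  by_contra hne
  have hU : {y | q y ≠ 0} ∈ 𝓝 x := (isOpen_ne_fun hq continuous_const).mem_nhds hne
  exact (((Measure.mem_support_iff_forall x).1 hx) _ hU).ne' h

/-- If the translates `b.tv.map (p x)` depend weakly continuously on `x`, then those with `x` in the
support of `a` are dominated by one finite Radon measure. -/
theorem exists_dominating_measure {p : S → S → S} (hp : Continuous fun q : S × S => p q.1 q.2)
    (a b : RadonMeasure S)
    (hb : ∀ E, MeasurableSet E → Continuous fun x => (b.tv.map (p x)).real E) :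
    ∃ l : RadonMeasure S, ∀ x ∈ a.tv.support, b.tv.map (p x) ≪ l.tv := by
  have hpx : ∀ x, Continuous (p x) := fun x => hp.comp (Continuous.prodMk_right x)
  obtain ⟨ρ, hρ, e⟩ : ∃ ρ ∈ radonSubmodule S, ∀ f : C_c(S, ℂ), cint ρ f =
      cint (ofMeasure b.tv) fun y => cint (ofMeasure a.tv) fun x => f (p x y) := by
    -- Associativity plays no role in forming the convolution of two measures, so `p` can serve as
    -- the product. This treats `x * y` and `y * x` together.
    let _ : Mul S := ⟨p⟩
    have : ContinuousMul S := ⟨hp⟩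
    obtain ⟨ρ, hρ, e⟩ := exists_conv_pos a.tv b.tv (k := fun _ _ => 1) continuous_const
      (fun _ _ => zero_le_one) fun _ _ => le_rfl
    refine ⟨ρ, hρ, fun f => (e f).trans ?_⟩
    simp only [Complex.ofReal_one, one_mul]
    rfl
  refine ⟨⟨ρ, hρ⟩, fun x hx => ?_⟩
  change b.tv.map (p x) ≪ ρ.variation
  have hreg : ρ.variation.Regular := hρ
  have hcomp : ∀ E, IsCompact E → ρ.variation E = 0 → b.tv.map (p x) E = 0 := by
    intro E hE h0
    have hEm := hE.measurableSet
    have hle : ∀ x, (b.tv.map (p x)).real E ≤ b.tv.real univ := fun x => by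
      rw [map_measureReal_apply (hpx x).measurable hEm]
      exact measureReal_mono (subset_univ _)
    have hi : Integrable (fun x => (b.tv.map (p x)).real E) a.tv :=
      Integrable.of_bound (hb E hEm).aestronglyMeasurable (b.tv.real univ)
        (Eventually.of_forall fun x => by
          rw [Real.norm_of_nonneg measureReal_nonneg]
          exact hle x)
    -- Majorize the indicator of `E` by `r`. After an exchange of integrals, the double integral of
    -- `r (p x y)` is `cint ρ φ`, which is at most `ε` in norm since `E` is `ρ`-null.
    have hint : ∫ x, (b.tv.map (p x)).real E ∂a.tv = 0 := by
      refine le_antisymm ?_ (integral_nonneg fun _ => measureReal_nonneg)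
      refine le_of_forall_pos_le_add fun ε hε => ?_
      obtain ⟨φ, r, hφr, hr01, hr1, hφ⟩ := exists_cc_approx ρ.variation hE hε
      have hE0 : ∀ᵐ x ∂ρ.variation, x ∉ E := measure_eq_zero_iff_ae_notMem.1 h0
      have h1 : ‖cint ρ φ‖ ≤ ε := by
        refine (norm_cint_le _ _).trans (le_trans (le_of_eq ?_) hφ)
        refine integral_congr_ae ?_
        filter_upwards [hE0] with x hx
        simp [hx]
      have hc : Continuous fun q : S × S => φ (p q.1 q.2) := φ.continuous.comp hp
      have hbd : ∀ x y, ‖φ (p x y)‖ ≤ 1 := fun x y => by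
        rw [hφr, Complex.norm_real, Real.norm_of_nonneg (hr01 _).1]
        exact (hr01 _).2
      have h2 : cint ρ φ = ((∫ x, ∫ y, r (p x y) ∂b.tv ∂a.tv : ℝ) : ℂ) := by
        rw [e, cint_swap (ofMeasure_mem _) (ofMeasure_mem _) hc 1 hbd]
        simp only [cint_ofMeasure, hφr, integral_complex_ofReal]
      have hri : ∀ x, Integrable (fun y => r (p x y)) b.tv := fun x =>
        Integrable.of_bound (r.continuous.comp (hpx x)).aestronglyMeasurable 1
          (Eventually.of_forall fun y => by
            rw [Real.norm_of_nonneg (hr01 _).1]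
            exact (hr01 _).2)
      have hrc : Continuous fun x => ∫ y, r (p x y) ∂b.tv := by
        have h3 := continuous_cint (h := fun y x => φ (p x y)) (ofMeasure_mem b.tv)
          (hc.comp continuous_swap) 1 (fun y x => hbd x y)
        simp only [cint_ofMeasure, hφr, integral_complex_ofReal] at h3
        exact Complex.continuous_re.comp h3
      have h4 : ∀ x, (b.tv.map (p x)).real E ≤ ∫ y, r (p x y) ∂b.tv := fun x => by
        have hm : MeasurableSet (p x ⁻¹' E) := (hpx x).measurable hEm
        rw [map_measureReal_apply (hpx x).measurable hEm, ← integral_indicator_one hm]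
        refine integral_mono ((integrable_const 1).indicator hm) (hri x) fun y => ?_
        by_cases hy : p x y ∈ E
        · have hy' : y ∈ p x ⁻¹' E := hy
          simp [hy', hr1 _ hy]
        · have hy' : y ∉ p x ⁻¹' E := hy
          simp [hy', (hr01 _).1]
      have h5 : Integrable (fun x => ∫ y, r (p x y) ∂b.tv) a.tv :=
        Integrable.of_bound hrc.aestronglyMeasurable (b.tv.real univ)
          (Eventually.of_forall fun x => by
            refine (norm_integral_le_integral_norm _).trans ?_
            refine (integral_mono (hri x).norm (integrable_const 1) fun y => ?_).trans (by simp)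
            rw [Real.norm_of_nonneg (hr01 _).1]
            exact (hr01 _).2)
      rw [zero_add]
      refine (integral_mono hi h5 h4).trans ?_
      rw [h2, Complex.norm_real] at h1
      exact (le_abs_self _).trans h1
    have := eq_zero_of_mem_support (hb E hEm) (fun _ => measureReal_nonneg) hi hint hx
    rwa [measureReal_eq_zero_iff (measure_ne_top _ _)] at this
  have hreg' : (b.tv.map (p x)).Regular := regular_map inferInstance (hpx x)
  refine Measure.AbsolutelyContinuous.mk fun A hA h0 => ?_
  by_contra hne
  obtain ⟨K, hKA, hK, hlt⟩ := hA.exists_lt_isCompact_of_ne_top (measure_ne_top (b.tv.map (p x)) A)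
    (pos_iff_ne_zero.2 hne)
  exact hlt.ne' (hcomp K hK (measure_mono_null hKA h0))

/-- A functional `F` applied to a convolution `∫ L x da(x)` is a limit of integrals of bounded
continuous functions converging to `F (L x)` pointwise on the support of `a`. -/
theorem exists_seq_tendsto_functional {p : S → S → S} (hp : Continuous fun q : S × S => p q.1 q.2)
    {k : S → S → ℝ} (hk : Continuous fun q : S × S => k q.1 q.2) (hk0 : ∀ x y, 0 ≤ k x y)
    (hk1 : ∀ x y, k x y ≤ 1) (a b : RadonMeasure S)
    (hb : ∀ E, MeasurableSet E → Continuous fun x => (b.tv.map (p x)).real E)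
    {L : S → RadonMeasure S} {L₀ : RadonMeasure S} (w : S → ℝ)
    (hL : ∀ x (φ : C_c(S, ℂ)), cint (L x).toComplex φ =
      w x * cint b.toComplex fun y => k x y * φ (p x y))
    (hL₀ : ∀ φ : C_c(S, ℂ), cint L₀.toComplex φ =
      cint a.toComplex fun x => cint b.toComplex fun y => k x y * φ (p x y))
    (F : RadonMeasure S →L[ℂ] ℂ) :
    ∃ (h : ℕ → S → ℂ) (C : ℝ), (∀ n, Continuous (h n)) ∧ (∀ n x, ‖h n x‖ ≤ C) ∧
      Tendsto (fun n => cint a.toComplex (h n)) atTop (𝓝 (F L₀)) ∧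
      ∀ x ∈ a.tv.support, Tendsto (fun n => w x * h n x) atTop (𝓝 (F (L x))) := by
  have hpx : ∀ x, Continuous (p x) := fun x => hp.comp (Continuous.prodMk_right x)
  obtain ⟨l, hl⟩ := exists_dominating_measure hp a b hb
  have hreg : (l.tv + L₀.tv).Regular := regular_add inferInstance inferInstance
  -- Adding `L₀.tv` makes the same sequence compute `F` at `L₀` and at every `L x` with `x` in the
  -- support of `a`.
  obtain ⟨φ, C, hC, hφ⟩ := RadonMeasure.exists_dual_seq F (l.tv + L₀.tv)
  have hcont : ∀ f : C_c(S, ℂ), Continuous fun q : S × S => (k q.1 q.2 : ℂ) * f (p q.1 q.2) :=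
    fun f => (Complex.continuous_ofReal.comp hk).mul (f.continuous.comp hp)
  have hker : ∀ (f : C_c(S, ℂ)) x y, ‖(k x y : ℂ) * f (p x y)‖ ≤ ‖f (p x y)‖ := fun f x y => by
    rw [norm_mul, Complex.norm_real, Real.norm_of_nonneg (hk0 x y)]
    exact mul_le_of_le_one_left (norm_nonneg _) (hk1 x y)
  have hbd : ∀ n x y, ‖(k x y : ℂ) * φ n (p x y)‖ ≤ C := fun n x y =>
    (hker _ x y).trans (hC n _)
  -- As `0 ≤ k ≤ 1`, integration against `L x` is bounded on `C_c(S)` by `|w x|` times integration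
  -- of the modulus against the translate of `b.tv`.
  have hac : ∀ x, (L x).tv ≪ b.tv.map (p x) := fun x => by
    have hreg' : (b.tv.map (p x)).Regular := regular_map inferInstance (hpx x)
    refine absolutelyContinuous_of_cint_le (L x).toComplex_mem (abs_nonneg (w x)) fun f => ?_
    rw [hL, norm_mul, Complex.norm_real, Real.norm_eq_abs]
    refine mul_le_mul_of_nonneg_left ?_ (abs_nonneg _)
    refine (norm_cint_le _ _).trans ?_
    have hfm : AEStronglyMeasurable (fun z => ‖f z‖) (b.tv.map (p x)) :=
      f.continuous.norm.aestronglyMeasurable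
    rw [integral_map (hpx x).aemeasurable hfm]
    obtain ⟨D, hD⟩ := f.hasCompactSupport.exists_bound_of_continuous f.continuous
    refine integral_mono
      (integrable_of_continuous _ ((hcont f).comp (Continuous.prodMk_right x)) D
        fun y => (hker f x y).trans (hD _)).norm
      (integrable_of_continuous _ (f.continuous.comp (hpx x)) D fun y => hD _).norm
      fun y => hker f x y
  refine ⟨fun n x => cint b.toComplex fun y => k x y * φ n (p x y),
    C * b.toComplex.variation.real univ, fun n => ?_, fun n x => ?_, ?_, fun x hx => ?_⟩
  · exact continuous_cint (h := fun y x => (k x y : ℂ) * φ n (p x y)) b.toComplex_mem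
      ((hcont (φ n)).comp continuous_swap) C fun y x => hbd n x y
  · exact norm_cint_le_of_bound _ ((hcont (φ n)).comp (Continuous.prodMk_right x)) C
      fun y => hbd n x y
  · have h1 := hφ L₀ (Measure.le_add_left le_rfl).absolutelyContinuous
    simpa only [hL₀] using h1
  · have h1 := hφ (L x) (((hac x).trans (hl x hx)).trans
      (Measure.le_add_right le_rfl).absolutelyContinuous)
    simpa only [hL] using h1

end Action

/-! ### Hahn–Banach and the reduction to finite families. -/

theorem mem_topologicalClosure_of_forall_dual {Z : Type*} [NormedAddCommGroup Z] [NormedSpace ℂ Z]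
    (D : Submodule ℂ Z) {z : Z} (h : ∀ f : Z →L[ℂ] ℂ, (∀ d ∈ D, f d = 0) → f z = 0) :
    z ∈ D.topologicalClosure := by
  have hcl : IsClosed (D.topologicalClosure : Set Z) := D.isClosed_topologicalClosure
  rw [← Submodule.Quotient.mk_eq_zero D.topologicalClosure]
  by_contra hne
  -- A norming functional of the class of `z` pulls back to a functional that kills `D` but not `z`.
  obtain ⟨g, -, hg⟩ := exists_dual_vector ℂ (Submodule.Quotient.mk z : Z ⧸ D.topologicalClosure)
    (norm_ne_zero_iff.2 hne)
  have h1 := h (g.comp D.topologicalClosure.mkQL) fun d hd => by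
    have : (Submodule.Quotient.mk d : Z ⧸ D.topologicalClosure) = 0 :=
      (Submodule.Quotient.mk_eq_zero _).2 (D.le_topologicalClosure hd)
    change g (Submodule.Quotient.mk d) = 0
    rw [this, map_zero]
  change g (Submodule.Quotient.mk z) = 0 at h1
  rw [h1] at hg
  exact hne (norm_eq_zero.1 (Complex.ofReal_eq_zero.1 hg.symm))

theorem dense_of_withSeminorms {ι E : Type*} [AddCommGroup E] [Module ℂ E]
    {p : SeminormFamily ℂ E ι} [TopologicalSpace E] (hp : WithSeminorms p) {D : Set E}
    (h : ∀ (x : E) (s : Finset ι) (r : ℝ), 0 < r → ∃ d ∈ D, ∀ i ∈ s, p i (d - x) < r) :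
    Dense D := by
  intro x
  rw [mem_closure_iff_nhds]
  intro U hU
  obtain ⟨s, r, hr, hs⟩ := (hp.mem_nhds_iff x U).1 hU
  obtain ⟨d, hd, hlt⟩ := h x s r hr
  exact ⟨d, hs ((s.sup p).mem_ball.2 (Seminorm.finset_sup_apply_lt hr hlt)), hd⟩

theorem functional_pi_eq_sum {ι Z : Type*} [Fintype ι] [DecidableEq ι] [NormedAddCommGroup Z]
    [NormedSpace ℂ Z] (f : (ι → Z) →L[ℂ] ℂ) (z : ι → Z) :
    f z = ∑ i, f.comp (ContinuousLinearMap.single ℂ (fun _ => Z) i) (z i) := by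
  conv_lhs => rw [← Finset.univ_sum_single z, map_sum]
  rfl

/-! ### Consequences of weak continuity. -/

section Regular

variable {S : Type*} [TopologicalSpace S] [T2Space S] [MeasurableSpace S] [BorelSpace S]

theorem regular_dirac (x : S) : (Measure.dirac x).Regular := by
  have : (Measure.dirac x).InnerRegularCompactLTTop := by
    constructor
    rintro A ⟨hA, -⟩ r hr
    by_cases hx : x ∈ A
    · refine ⟨{x}, singleton_subset_iff.2 hx, isCompact_singleton, ?_⟩
      rw [Measure.dirac_apply_of_mem hx] at hr
      rwa [Measure.dirac_apply_of_mem (mem_singleton x)]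
    · rw [Measure.dirac_apply' x hA, indicator_of_notMem hx] at hr
      exact absurd hr not_lt_zero
  infer_instance

theorem continuous_of_weakly_continuous {f : S → RadonMeasure S}
    (hf : Continuous fun x => toWeakSpace ℂ (RadonMeasure S) (f x)) (F : RadonMeasure S →L[ℂ] ℂ) :
    Continuous fun x => F (f x) :=
  (WeakBilin.eval_continuous (topDualPairing ℂ (RadonMeasure S)).flip F).comp hf

/-- The indicator of a Borel set defines an element of the dual of `M(S)`. This is how membership in
`M_a(S)` enters: testing on `C_c(S)` alone would not control the measure of a fixed Borel set. -/
theorem continuous_measureReal_of_weakly_continuous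
    {f : S → Measure S} [∀ x, IsFiniteMeasure (f x)] (h : ∀ x, (f x).Regular)
    (hf : Continuous fun x => toWeakSpace ℂ (RadonMeasure S) (RadonMeasure.ofRegular (f x) (h x)))
    (E : Set S) (hE : MeasurableSet E) : Continuous fun x => (f x).real E := by
  have h1 := continuous_of_weakly_continuous hf (RadonMeasure.cintCLM (E.indicator fun _ => 1)
    (measurable_const.indicator hE) 1 fun x => by
      by_cases hx : x ∈ E <;> simp [hx])
  refine (Complex.continuous_re.comp h1).congr fun x => ?_
  change (cint (ofMeasure (f x)) _).re = _
  rw [cint_indicator _ hE, ofMeasure_apply _ hE, Complex.ofReal_re]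

end Regular

/-! ### Point masses in `M(S,ω)` and strict density. -/

namespace WeightedMeasure

variable {S : Type*} [TopologicalSpace S] [T2Space S] [LocallyCompactSpace S] [MeasurableSpace S]
  [BorelSpace S] [Mul S] {ω : Weight S}

variable (ω) in
/-- The point mass at `x` as an element of `M(S,ω)`. -/
noncomputable def dirac (x : S) : WeightedMeasure ω :=
  ⟨{ toFun := fun f => f x
     map_add' := fun _ _ => rfl
     map_smul' := fun _ _ => rfl },
   (ω x : ℂ) • RadonMeasure.ofRegular (Measure.dirac x) (regular_dirac x), fun f => by
    rw [RadonMeasure.toComplex_smul, cint_smul_measure _ (integrable_cc _ f)]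
    change ω.mul f x = ω x * cint (ofMeasure (Measure.dirac x)) f
    rw [cint_ofMeasure, integral_dirac, ω.mul_apply]⟩

theorem dirac_toFunctional (x : S) (f : C_c(S, ℂ)) : (dirac ω x).toFunctional f = f x := rfl

theorem dirac_weighted (x : S) : (dirac ω x).weighted =
    (ω x : ℂ) • RadonMeasure.ofRegular (Measure.dirac x) (regular_dirac x) :=
  eq_weighted fun f => by
    rw [RadonMeasure.toComplex_smul, cint_smul_measure _ (integrable_cc _ f)]
    change ω.mul f x = ω x * cint (ofMeasure (Measure.dirac x)) f
    rw [cint_ofMeasure, integral_dirac, ω.mul_apply]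

theorem cint_dirac_weighted (x : S) {g : S → ℂ} (hg : Continuous g) {C : ℝ}
    (hC : ∀ y, ‖g y‖ ≤ C) : cint (dirac ω x).weighted.toComplex g = ω x * g x := by
  rw [dirac_weighted, RadonMeasure.toComplex_smul,
    cint_smul_measure _ (integrable_of_continuous _ hg C hC)]
  change ω x * cint (ofMeasure (Measure.dirac x)) g = _
  rw [cint_ofMeasure, integral_dirac]

theorem dirac_span_subset_l1 {d : WeightedMeasure ω} (hd : d ∈ Submodule.span ℂ (range (dirac ω))) :
    d ∈ l1 ω := by
  classical
  refine Submodule.span_induction ?_ ?_ ?_ ?_ hd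
  · rintro _ ⟨x, rfl⟩
    refine ⟨Pi.single x 1, ?_, fun f => ?_⟩
    · refine summable_of_ne_finset_zero (s := {x}) fun y hy => ?_
      rw [Finset.mem_singleton] at hy
      simp [hy]
    · have := hasSum_single (f := fun y => (Pi.single x (1 : ℂ) : S → ℂ) y * f y) x
        fun y hy => by simp [hy]
      simpa [dirac_toFunctional] using this
  · exact ⟨0, by simp, fun f => by
      have : (0 : WeightedMeasure ω).toFunctional f = 0 := rfl
      rw [this]
      simp⟩
  · rintro a b - - ⟨c, h1, h2⟩ ⟨c', h1', h2'⟩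
    refine ⟨c + c', ?_, fun f => ?_⟩
    · refine Summable.of_nonneg_of_le (fun x => mul_nonneg (norm_nonneg _) (ω.pos x).le)
        (fun x => ?_) (h1.add h1')
      rw [← add_mul]
      exact mul_le_mul_of_nonneg_right (norm_add_le _ _) (ω.pos x).le
    · rw [toFunctional_add, LinearMap.add_apply]
      simpa only [Pi.add_apply, add_mul] using (h2 f).add (h2' f)
  · rintro t a - ⟨c, h1, h2⟩
    refine ⟨t • c, ?_, fun f => ?_⟩
    · simpa only [Pi.smul_apply, norm_smul, mul_assoc] using h1.mul_left ‖t‖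
    · simpa only [Pi.smul_apply, smul_eq_mul, mul_assoc, toFunctional_smul] using!
        (h2 f).mul_left t

variable [ContinuousMul S]

/-- The kernel `ω(xy) / (ω(x) ω(y))`. -/
noncomputable def kernel (ω : Weight S) (x y : S) : ℝ := ω (x * y) / (ω x * ω y)

theorem norm_kernel_mul_le (φ : C_c(S, ℂ)) {C : ℝ} (hC : ∀ x, ‖φ x‖ ≤ C) (x y : S) :
    ‖(kernel ω x y : ℂ) * φ (x * y)‖ ≤ C := by
  rw [norm_mul, Complex.norm_real, kernel, Real.norm_of_nonneg (kernel_nonneg x y)]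
  exact (mul_le_of_le_one_left (norm_nonneg _) (kernel_le_one x y)).trans (hC _)

theorem continuous_kernel_mul (φ : C_c(S, ℂ)) :
    Continuous fun q : S × S => (kernel ω q.1 q.2 : ℂ) * φ (q.1 * q.2) :=
  (Complex.continuous_ofReal.comp continuous_kernel).mul (φ.continuous.comp continuous_mul)

theorem cint_mul_weighted (μ ν : WeightedMeasure ω) (φ : C_c(S, ℂ)) :
    cint (μ * ν).weighted.toComplex φ = cint ν.weighted.toComplex fun y =>
      cint μ.weighted.toComplex fun x => (kernel ω x y : ℂ) * φ (x * y) := by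
  rw [← weighted_spec, mul_toFunctional, conv_kernel, ω.div_mul]
  rfl

/-- With both orders of integration available, the variable measure can be kept outermost on
whichever side it stands. -/
theorem cint_mul_weighted' (μ ν : WeightedMeasure ω) (φ : C_c(S, ℂ)) :
    cint (μ * ν).weighted.toComplex φ = cint μ.weighted.toComplex fun x =>
      cint ν.weighted.toComplex fun y => (kernel ω x y : ℂ) * φ (x * y) := by
  obtain ⟨C, hC⟩ := φ.hasCompactSupport.exists_bound_of_continuous φ.continuous
  rw [cint_mul_weighted]
  exact cint_swap μ.weighted.toComplex_mem ν.weighted.toComplex_mem (continuous_kernel_mul φ) C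
    (norm_kernel_mul_le φ hC)

variable (ω) in
/-- The map `μ ↦ ω (μ * ν)` (for `false`) or `μ ↦ ω (ν * μ)` (for `true`). -/
noncomputable def sideConv (ν : WeightedMeasure ω) (left : Bool) :
    WeightedMeasure ω →ₗ[ℂ] RadonMeasure S :=
  (weightedₗ ω).comp (bif left then convₗ ω ν else (convₗ ω).flip ν)

theorem sideConv_true (ν μ : WeightedMeasure ω) : sideConv ω ν true μ = (ν * μ).weighted := rfl

theorem sideConv_false (ν μ : WeightedMeasure ω) : sideConv ω ν false μ = (μ * ν).weighted := rfl

/-- The two sides are `p x y = x * y` and `p x y = y * x`, each using its own half of the definition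
of `M_a(S)`. The factor `ω x` appears because the weighted measure of `δ_x` is `ω(x) δ_x`. -/
theorem exists_seq_tendsto_sideConv (μ : WeightedMeasure ω) {ν : WeightedMeasure ω} (hν : ν ∈ Ma ω)
    (left : Bool) (F : RadonMeasure S →L[ℂ] ℂ) :
    ∃ (h : ℕ → S → ℂ) (C : ℝ), (∀ n, Continuous (h n)) ∧ (∀ n x, ‖h n x‖ ≤ C) ∧
      Tendsto (fun n => cint μ.weighted.toComplex (h n)) atTop (𝓝 (F (sideConv ω ν left μ))) ∧
      ∀ x ∈ μ.weighted.tv.support,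
        Tendsto (fun n => ω x * h n x) atTop (𝓝 (F (sideConv ω ν left (dirac ω x)))) := by
  have hbound : ∀ φ : C_c(S, ℂ), ∃ C, ∀ x, ‖φ x‖ ≤ C := fun φ =>
    φ.hasCompactSupport.exists_bound_of_continuous φ.continuous
  cases left with
  | false =>
    refine exists_seq_tendsto_functional (p := fun x y => x * y) continuous_mul
      (k := kernel ω) continuous_kernel kernel_nonneg kernel_le_one μ.weighted ν.weighted
      (continuous_measureReal_of_weakly_continuous _ hν.1)
      (L := fun x => sideConv ω ν false (dirac ω x)) ω
      (fun x φ => ?_) (fun φ => cint_mul_weighted' μ ν φ) F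
    obtain ⟨C, hC⟩ := hbound φ
    rw [sideConv_false, cint_mul_weighted, ← cint_const_mul]
    exact cint_congr fun y => cint_dirac_weighted x
      ((continuous_kernel_mul φ).comp (Continuous.prodMk_left y))
      fun z => norm_kernel_mul_le φ hC z y
  | true =>
    refine exists_seq_tendsto_functional (p := fun x y => y * x)
      (continuous_mul.comp continuous_swap)
      (k := fun x y => kernel ω y x) (continuous_kernel.comp continuous_swap)
      (fun x y => kernel_nonneg y x) (fun x y => kernel_le_one y x) μ.weighted ν.weighted
      (continuous_measureReal_of_weakly_continuous _ hν.2)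
      (L := fun x => sideConv ω ν true (dirac ω x)) ω
      (fun x φ => ?_) (fun φ => cint_mul_weighted ν μ φ) F
    obtain ⟨C, hC⟩ := hbound φ
    rw [sideConv_true, cint_mul_weighted', ← cint_const_mul]
    exact cint_congr fun y => cint_dirac_weighted x
      ((continuous_kernel_mul φ).comp (Continuous.prodMk_right y))
      fun z => norm_kernel_mul_le φ hC y z

/-- A functional on a finite power of `M(S)` that vanishes on the convolutions of point masses with
given elements of `M_a(S,ω)` vanishes on the convolutions of all elements of `M(S,ω)` with them. -/
theorem sum_functional_eq_zero {ι : Type*} [Fintype ι] (ν : ι → WeightedMeasure ω)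
    (hν : ∀ i, ν i ∈ Ma ω) (left : ι → Bool) (F : ι → RadonMeasure S →L[ℂ] ℂ)
    (hF : ∀ x, ∑ i, F i (sideConv ω (ν i) (left i) (dirac ω x)) = 0) (μ : WeightedMeasure ω) :
    ∑ i, F i (sideConv ω (ν i) (left i) μ) = 0 := by
  choose h C hc hC hlim hx using fun i => exists_seq_tendsto_sideConv μ (hν i) (left i) (F i)
  have h1 : Tendsto (fun n => cint μ.weighted.toComplex fun x => ∑ i, h i n x) atTop
      (𝓝 (∑ i, F i (sideConv ω (ν i) (left i) μ))) := by
    refine (tendsto_finsetSum Finset.univ fun i _ => hlim i).congr fun n => ?_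
    exact (VectorMeasure.integral_finsetSum Finset.univ fun i _ =>
      integrable_of_continuous _ (hc i n) (C i) (hC i n)).symm
  -- Only the sum over `i` is known to vanish on point masses, so the sequences are added before the
  -- limit is taken. Bounded convergence needs the pointwise limit only on the support, which has
  -- full measure; there the factor `ω x` is divided out.
  have h2 : Tendsto (fun n => cint μ.weighted.toComplex fun x => ∑ i, h i n x) atTop
      (𝓝 (cint μ.weighted.toComplex fun _ => 0)) := by
    refine tendsto_cint (∑ i, C i) (fun n => (continuous_finsetSum _ fun i _ =>
      hc i n).aestronglyMeasurable)
      (fun n x => (norm_sum_le _ _).trans (Finset.sum_le_sum fun i _ => hC i n x)) ?_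
    have hsupp : ∀ᵐ x ∂μ.weighted.tv, x ∈ μ.weighted.tv.support :=
      Measure.support_mem_ae_of_regular
    filter_upwards [hsupp] with x hxs
    have h3 : Tendsto (fun n => ∑ i, ω x * h i n x) atTop (𝓝 0) := by
      rw [← hF x]
      exact tendsto_finsetSum Finset.univ fun i _ => hx i x hxs
    have h4 := h3.const_mul ((ω x : ℂ)⁻¹)
    rw [mul_zero] at h4
    refine h4.congr fun n => ?_
    rw [← Finset.mul_sum, inv_mul_cancel_left₀ (ω.ne_zero x)]
  have h3 : (cint μ.weighted.toComplex fun _ => 0) = 0 := by simp [cint]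
  rw [h3] at h2
  exact tendsto_nhds_unique h1 h2

/-- All convolutions must be approximated by the same `d`, so Hahn–Banach is applied to the tuple in
the finite power of `M(S)`, where a functional splits into coordinate functionals. -/
theorem exists_dirac_span_approx {ι : Type*} [Fintype ι] (ν : ι → WeightedMeasure ω)
    (hν : ∀ i, ν i ∈ Ma ω) (left : ι → Bool) (μ : WeightedMeasure ω) {r : ℝ} (hr : 0 < r) :
    ∃ d ∈ Submodule.span ℂ (range (dirac ω)),
      ∀ i, ‖sideConv ω (ν i) (left i) (d - μ)‖ < r := by
  classical
  let T : WeightedMeasure ω →ₗ[ℂ] (ι → RadonMeasure S) :=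
    LinearMap.pi fun i => sideConv ω (ν i) (left i)
  have hmem := mem_topologicalClosure_of_forall_dual
    ((Submodule.span ℂ (range (dirac ω))).map T) (z := T μ) fun f hf => by
      rw [functional_pi_eq_sum f]
      refine sum_functional_eq_zero ν hν left _ (fun x => ?_) μ
      have := hf (T (dirac ω x)) (Submodule.mem_map_of_mem (Submodule.subset_span ⟨x, rfl⟩))
      rwa [functional_pi_eq_sum f] at this
  obtain ⟨_, ⟨d, hd, rfl⟩, hlt⟩ := Metric.mem_closure_iff.1 hmem r hr
  refine ⟨d, hd, fun i => ?_⟩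
  have h1 := (dist_le_pi_dist (T μ) (T d) i).trans_lt hlt
  rwa [dist_comm, dist_eq_norm, ← Pi.sub_apply, ← map_sub] at h1

theorem exists_l1_approx (μ : WeightedMeasure ω) (s : Finset (Ma ω)) {r : ℝ} (hr : 0 < r) :
    ∃ d ∈ l1 ω, ∀ ν ∈ s, strictSeminorm (ν : WeightedMeasure ω) (d - μ) < r := by
  -- Each `ν` occurs twice, once per side, and each side may contribute `r / 2` to the seminorm.
  obtain ⟨d, hd, hlt⟩ := exists_dirac_span_approx (ι := {ν // ν ∈ s} × Bool)
    (fun i => i.1.1.1) (fun i => i.1.1.2) (fun i => i.2) μ (half_pos hr)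
  refine ⟨d, dirac_span_subset_l1 hd, fun ν hν => ?_⟩
  have h1 : ‖sideConv ω (ν : WeightedMeasure ω) false (d - μ)‖ < r / 2 := hlt (⟨ν, hν⟩, false)
  have h2 : ‖sideConv ω (ν : WeightedMeasure ω) true (d - μ)‖ < r / 2 := hlt (⟨ν, hν⟩, true)
  rw [sideConv_false] at h1
  rw [sideConv_true] at h2
  calc strictSeminorm (ν : WeightedMeasure ω) (d - μ)
      = ‖((d - μ) * (ν : WeightedMeasure ω)).weighted‖ +
        ‖((ν : WeightedMeasure ω) * (d - μ)).weighted‖ := strictSeminorm_apply _ _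
    _ < r := by linarith

theorem dense_l1 (ω : Weight S) : @Dense (WeightedMeasure ω) (strictTopology ω) (l1 ω) := by
  have hp : @WithSeminorms ℂ (WeightedMeasure ω) (Ma ω) _ instAddCommGroup instModuleComplex
      (fun ν : Ma ω => strictSeminorm (ν : WeightedMeasure ω)) (strictTopology ω) :=
    @WithSeminorms.mk ℂ (WeightedMeasure ω) (Ma ω) _ _ _ _ (strictTopology ω) rfl
  exact @dense_of_withSeminorms (Ma ω) (WeightedMeasure ω) instAddCommGroup instModuleComplex
    (fun ν : Ma ω => strictSeminorm (ν : WeightedMeasure ω)) (strictTopology ω) hp (l1 ω)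
    fun μ s r hr => exists_l1_approx μ s hr

end WeightedMeasure

end FoundationSemigroup

/-- Weak continuity of translation on `M_a(S,ω)` suffices for the density of `ℓ¹(S,ω)`: the
hypothesis that `S` is a foundation semigroup is not used. -/
theorem theorem2p4 {S : Type*} [TopologicalSpace S] [T2Space S] [LocallyCompactSpace S]
    [Monoid S] [ContinuousMul S] [MeasurableSpace S] [BorelSpace S]
    (hS : FoundationSemigroup.IsFoundation S) (ω : FoundationSemigroup.Weight S) :
    @Dense (FoundationSemigroup.WeightedMeasure ω)
      (FoundationSemigroup.WeightedMeasure.strictTopology ω)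
      (FoundationSemigroup.WeightedMeasure.l1 ω) :=
  FoundationSemigroup.WeightedMeasure.dense_l1 ω
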